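/- Let $k\ge 1$ be an integer. Let $T_k$ be the $(k+1)$-regular tree (the countably infinite tree in which every vertex has degree $k+1$), and let $T_k^*$ be the infinite tree with a root $v_0$ of degree $k$ in which every other vertex has degree $k+1$. Blocking RSA on a graph with vertex set $V$ is defined as follows. Let $(\tau_v)_{v\in V}$ be independent random variables, uniformly distributed on $(0,1)$. If $V$ is finite, all sites are vacant at first, a particle arrives at site $v$ at time $\tau_v$, and $v$ then becomes (and stays) occupied if and only if none of its neighbours is already occupied; set $X_t^V(v)=1$ if $v$ is occupied at time $t$ and $X_t^V(v)=0$ otherwise. If $V$ is countably infinite with bounded degrees, $X_t^V(v):=\lim_{n\to\infty}X_t^{V_n}(v)$ for any sequence of finite sets $V_n\subseteq V$ (with the induced graph structure and the same arrival times) such that every vertex lies in all but finitely many $V_n$; almost surely, for all $v\in V$ and $t\in[0,1]$, this limit exists and does not depend on the sequence. Set $\beta(t):=P[X_t^{T_k^*}(v_0)=0]$. Then for all $0\le t\le 1$ we have $\beta(t)>0$, and for every integer $m\ge 1$ and all vertices $v,w$ of $T_k$ at graph distance $m$, $$\operatorname{Cov}\bigl(X_t^{T_k}(v),X_t^{T_k}(w)\bigr)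 = -\frac{\beta(t)^2}{2}\sum_{n=0}^{\infty}\frac{(2\log\beta(t))^{m+1+2n}}{(m+1+2n)!},$$ where the series converges. -/

import Mathlib

open MeasureTheory ProbabilityTheory Filter Topology

noncomputable section

namespace BlockingRSA

variable {V : Type*}

/-- Blocking RSA on the finite graph induced by `G` on the finite vertex set `S`, with arrival
times `τ`: the particle arriving at `v ∈ S` at time `τ v` is accepted if and only if no neighbour
of `v` in `S` is already occupied, i.e. no neighbour in `S` with an earlier arrival time has had
its particle accepted. -/
def Accepted (G : SimpleGraph V) (τ : V → ℝ) (S : Finset V) (v : V) : Prop :=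
  v ∈ S ∧ ∀ w, ∀ hw : w ∈ S, G.Adj v w → ∀ hlt : τ w < τ v, ¬ Accepted G τ S w
termination_by (S.filter (fun w => τ w < τ v)).card
decreasing_by
  apply Finset.card_lt_card
  rw [Finset.ssubset_iff_of_subset]
  · exact ⟨w, by simp [hw, hlt], by simp⟩
  · intro x hx
    simp only [Finset.mem_filter] at hx ⊢
    exact ⟨hx.1, hx.2.trans hlt⟩

open Classical in
/-- The state at time `t` of site `v` for blocking RSA on the finite graph induced by `G` on `S`:
`1` if `v` is occupied (its particle has arrived by time `t` and was accepted), `0` if vacant. -/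
def finiteState (G : SimpleGraph V) (τ : V → ℝ) (S : Finset V) (t : ℝ) (v : V) : ℝ :=
  if τ v ≤ t ∧ Accepted G τ S v then 1 else 0

/-- The state at time `t` of site `v` for blocking RSA on all of `G`: the limit of the states for
the finite induced subgraphs. For countable `V`, convergence along the directed set of finite
subsets of `V` is the same as convergence, to a common limit, along every sequence `S₁, S₂, …` of
finite subsets such that each vertex belongs to all but finitely many of them. -/
def state (G : SimpleGraph V) (τ : V → ℝ) (t : ℝ) (v : V) : ℝ :=
  limUnder (atTop : Filter (Finset V)) (fun S => finiteState G τ S t v)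

variable {Ω : Type*} [MeasurableSpace Ω]

/-- The arrival times are independent and uniformly distributed on `(0, 1)`. -/
structure IsArrivalTimes (τ : V → Ω → ℝ) (P : Measure Ω) : Prop where
  measurable : ∀ v, Measurable (τ v)
  indep : iIndepFun τ P
  uniform : ∀ v, pdf.IsUniform (τ v) (Set.Ioo 0 1) P volume

/-- The limit defining the state exists almost surely, simultaneously for all sites and all
times in `[0, 1]`. -/
def WellDefined (G : SimpleGraph V) (τ : V → Ω → ℝ) (P : Measure Ω) : Prop :=
  ∀ᵐ ω ∂P, ∀ v : V, ∀ t ∈ Set.Icc (0 : ℝ) 1,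
    Tendsto (fun S : Finset V => finiteState G (fun u => τ u ω) S t v) atTop
      (𝓝 (state G (fun u => τ u ω) t v))

/-- The probability that site `v` is vacant at time `t`. -/
def vacancyProb (G : SimpleGraph V) (τ : V → Ω → ℝ) (P : Measure Ω) (v : V) (t : ℝ) : ℝ :=
  P.real {ω | state G (fun u => τ u ω) t v = 0}

/-- The covariance of the states of sites `v` and `w` at time `t`. -/
def siteCov (G : SimpleGraph V) (τ : V → Ω → ℝ) (P : Measure Ω) (t : ℝ) (v w : V) : ℝ :=
  covariance (fun ω => state G (fun u => τ u ω) t v) (fun ω => state G (fun u => τ u ω) t w) P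

/-- `G` is the `(k + 1)`-regular tree `T_k`: a tree in which every vertex has degree `k + 1`. -/
structure IsRegularTree (G : SimpleGraph V) (k : ℕ) : Prop where
  isTree : G.IsTree
  degree_eq : ∀ v, (G.neighborSet v).encard = k + 1

/-- `G` with root `v₀` is the rooted tree `T_k^*`: a tree in which the root has degree `k` and
every other vertex has degree `k + 1`. -/
structure IsRootedRegularTree (G : SimpleGraph V) (k : ℕ) (v₀ : V) : Prop where
  isTree : G.IsTree
  degree_root : (G.neighborSet v₀).encard = k
  degree_eq : ∀ v, v ≠ v₀ → (G.neighborSet v).encard = k + 1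

end BlockingRSA

end

noncomputable section

namespace BlockingRSA

variable {V : Type*} {G : SimpleGraph V} {x y : V → ℝ} {U B : Set V} {v w c : V}

/-! ### The finite process -/

/-! A path of `n` sites has decreasing arrival times with probability `1 / n!`, while the number of
paths from a site grows only exponentially. So almost surely no infinite chain of earlier neighbours
exists (`ae_wellFounded`), acceptance is defined by well-founded recursion, and the finite processes
stabilise at each site.

Until `v` arrives, the branches at `v` evolve independently, and `v` is accepted iff all its
neighbours are vacant at that moment. Conditioning on the arrival time expresses the vacancy
probability of `v` through those of its branches (`vacProb_eq`). Iterating these equations shows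
that all branches of both trees share one vacancy probability `β`, and it solves `β' = -β ^ k`, `β 0
= 1`.

Two sites fail to be both vacant iff one of them is accepted while the other is still vacant.
Conditioning on that arrival moves one end of the path a step towards the other, inside a branch
whose root lacks a neighbour (`vacProb₂_eq`). Only three kinds of pairs occur: both ends, one end or
no end lacking a neighbour, with probabilities `A`, `H`, `F`. With `b = β t` as the variable, the
equations lose all trace of `k`: `A_{m+1}' = 2 A_m / b`, `H_{m+1}' = H_m / b + A_m`, `F_{m+1}' = 2
H_m`, each function being `1` at `b = 1`. In `y = 2 log b` the first is plain integration, whence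
Taylor polynomials of `exp y = b ^ 2`; the last turns their remainders into the series of terms of
one parity. Subtracting the square of the one-site probability `F_0 = (1 + b ^ 2) / 2` from `F_m`
leaves that series times `-b ^ 2 / 2`. -/

theorem accepted_iff {S : Finset V} :
    Accepted G x S v ↔ v ∈ S ∧ ∀ w ∈ S, G.Adj v w → x w < x v → ¬ Accepted G x S w := by
  rw [Accepted]

theorem induction_on_arrival (S : Finset V) (x : V → ℝ) {p : V → Prop}
    (h : ∀ v, (∀ w ∈ S, x w < x v → p w) → p v) (v : V) : p v := by
  induction hn : (S.filter (fun u => x u < x v)).card using Nat.strong_induction_on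
    generalizing v with
  | _ n ih =>
    refine h v fun w hw hlt => ih _ ?_ w rfl
    rw [← hn]
    apply Finset.card_lt_card
    rw [Finset.ssubset_iff_of_subset]
    · exact ⟨w, by simp [hw, hlt], by simp⟩
    · intro u hu
      simp only [Finset.mem_filter] at hu ⊢
      exact ⟨hu.1, hu.2.trans hlt⟩

theorem accepted_erase_iff [DecidableEq V] {S : Finset V} (hwv : w ≠ v) (hle : x w ≤ x v) :
    Accepted G x (S.erase v) w ↔ Accepted G x S w := by
  induction w using induction_on_arrival S x with
  | h w ih =>
    rw [accepted_iff, accepted_iff (S := S)]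
    simp only [Finset.mem_erase]
    constructor
    · rintro ⟨⟨-, hw⟩, h⟩
      refine ⟨hw, fun u hu ha hlt => ?_⟩
      have huv : u ≠ v := by rintro rfl; linarith
      rw [← ih u hu hlt huv (hlt.le.trans hle)]
      exact h u ⟨huv, hu⟩ ha hlt
    · rintro ⟨hw, h⟩
      refine ⟨⟨hwv, hw⟩, fun u hu ha hlt => ?_⟩
      rw [ih u hu.2 hlt hu.1 (hlt.le.trans hle)]
      exact h u hu.2 ha hlt

/-- Sites arriving before `v` never consult `v`, so `v` may be deleted. This recursion shrinks `S`
regardless of the arrival times, which is what the measurability proof needs. -/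
theorem accepted_iff_erase [DecidableEq V] {S : Finset V} :
    Accepted G x S v ↔
      v ∈ S ∧ ∀ w ∈ S, G.Adj v w → x w < x v → ¬ Accepted G x (S.erase v) w := by
  rw [accepted_iff]
  refine and_congr_right fun _ => forall₂_congr fun w _ => forall_congr' fun ha =>
    forall_congr' fun hlt => ?_
  rw [accepted_erase_iff ha.ne' hlt.le]

theorem accepted_congr {S : Finset V} (h : ∀ u ∈ S, x u = y u) :
    Accepted G x S v ↔ Accepted G y S v := by
  induction v using induction_on_arrival S x with
  | h v ih =>
    rw [accepted_iff, accepted_iff (x := y)]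
    refine and_congr_right fun hv => forall₂_congr fun w hw => forall_congr' fun ha => ?_
    rw [← h v hv, ← h w hw]
    exact forall_congr' fun hlt => not_congr (ih w hw hlt)

theorem measurableSet_accepted (G : SimpleGraph V) (S : Finset V) (v : V) :
    MeasurableSet {x : V → ℝ | Accepted G x S v} := by
  classical
  induction S using Finset.strongInduction generalizing v with
  | H S ih =>
    by_cases hv : v ∈ S
    · have : {x : V → ℝ | Accepted G x S v} = ⋂ w ∈ S, {x | G.Adj v w → x w < x v →
          ¬ Accepted G x (S.erase v) w} := by
        ext x
        rw [Set.mem_ofPred_eq, accepted_iff_erase]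
        simp [hv]
      rw [this]
      refine Finset.measurableSet_biInter _ fun w _ => ?_
      refine MeasurableSet.imp (MeasurableSet.const _) (MeasurableSet.imp ?_ ?_)
      · exact measurableSet_lt (measurable_pi_apply w) (measurable_pi_apply v)
      · exact (ih _ (Finset.erase_ssubset hv) w).compl
    · convert MeasurableSet.empty
      ext x
      rw [Set.mem_ofPred_eq, accepted_iff]
      simp [hv]

/-! ### The process on an arbitrary set of sites -/

open Classical in
/-- The particle arriving at `v` is accepted by the process on the (possibly infinite) set `U`:
it is accepted by the processes on `S ∩ U` for all large finite sets `S`. -/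
def AcceptedIn (G : SimpleGraph V) (x : V → ℝ) (U : Set V) (v : V) : Prop :=
  ∀ᶠ S : Finset V in atTop, Accepted G x (S.filter (· ∈ U)) v

/-- `Precedes G x w v` if `w` is a neighbour of `v` whose particle arrives earlier. -/
def Precedes (G : SimpleGraph V) (x : V → ℝ) (w v : V) : Prop :=
  G.Adj v w ∧ x w < x v

open Classical in
-- Well-founded induction along earlier neighbours: once `S` contains `v` and its finitely many
-- neighbours and the earlier ones have stabilised, the recursion at `v` no longer depends on `S`.
-- Stabilisation and the limiting recursion feed each other, so they are proved together.
theorem eventually_accepted_iff_and_acceptedIn_iff (hG : ∀ v, (G.neighborSet v).Finite)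
    (hx : WellFounded (Precedes G x)) (U : Set V) (v : V) :
    (∀ᶠ S : Finset V in atTop, (Accepted G x (S.filter (· ∈ U)) v ↔ AcceptedIn G x U v)) ∧
      (AcceptedIn G x U v ↔
        v ∈ U ∧ ∀ w ∈ U, G.Adj v w → x w < x v → ¬ AcceptedIn G x U w) := by
  induction v using hx.induction with
  | _ v ih =>
    have key : ∀ᶠ S : Finset V in atTop, (Accepted G x (S.filter (· ∈ U)) v ↔
        v ∈ U ∧ ∀ w ∈ U, G.Adj v w → x w < x v → ¬ AcceptedIn G x U w) := by
      have h1 : ∀ᶠ S : Finset V in atTop, ∀ w ∈ G.neighborSet v, x w < x v →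
          (Accepted G x (S.filter (· ∈ U)) w ↔ AcceptedIn G x U w) := by
        rw [eventually_all_finite (hG v)]
        intro w hw
        by_cases hlt : x w < x v
        · filter_upwards [(ih w ⟨hw, hlt⟩).1] with S hS _ using hS
        · exact Eventually.of_forall fun S h => absurd h hlt
      filter_upwards [h1, eventually_ge_atTop (insert v (hG v).toFinset)] with S hS hsub
      have hvS : v ∈ S := hsub (Finset.mem_insert_self _ _)
      have hnS : ∀ w, G.Adj v w → w ∈ S := fun w hw =>
        hsub (Finset.mem_insert_of_mem (by simpa using hw))
      rw [accepted_iff]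
      simp only [Finset.mem_filter, hvS, true_and]
      refine and_congr_right fun _ => ⟨fun h w hw ha hlt => ?_, fun h w hw ha hlt => ?_⟩
      · rw [← hS w ha hlt]
        exact h w ⟨hnS w ha, hw⟩ ha hlt
      · rw [hS w ha hlt]
        exact h w hw.2 ha hlt
    have h2 : AcceptedIn G x U v ↔
        v ∈ U ∧ ∀ w ∈ U, G.Adj v w → x w < x v → ¬ AcceptedIn G x U w := by
      conv_lhs => unfold AcceptedIn
      rw [eventually_congr key, eventually_const]
    refine ⟨?_, h2⟩
    filter_upwards [key] with S hS
    rw [hS, h2]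

theorem acceptedIn_iff (hG : ∀ v, (G.neighborSet v).Finite) (hx : WellFounded (Precedes G x)) :
    AcceptedIn G x U v ↔ v ∈ U ∧ ∀ w ∈ U, G.Adj v w → x w < x v → ¬ AcceptedIn G x U w :=
  (eventually_accepted_iff_and_acceptedIn_iff hG hx U v).2

theorem eventually_accepted_iff (hG : ∀ v, (G.neighborSet v).Finite)
    (hx : WellFounded (Precedes G x)) (v : V) :
    ∀ᶠ S : Finset V in atTop, (Accepted G x S v ↔ AcceptedIn G x Set.univ v) := by
  simpa using (eventually_accepted_iff_and_acceptedIn_iff hG hx Set.univ v).1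

/-- The recursion started at `w` goes on only to sites arriving strictly before `v`. It therefore
never meets `v`, the only way out of `B`. -/
theorem acceptedIn_inter_iff (hG : ∀ v, (G.neighborSet v).Finite)
    (hx : WellFounded (Precedes G x)) (hB : ∀ y ∈ B, ∀ z, G.Adj y z → z ≠ v → z ∈ B)
    (hw : w ∈ B) (hle : x w ≤ x v) :
    AcceptedIn G x (U ∩ B) w ↔ AcceptedIn G x U w := by
  induction w using hx.induction with
  | _ w ih =>
    rw [acceptedIn_iff hG hx, acceptedIn_iff hG hx (U := U)]
    simp only [Set.mem_inter_iff, hw, and_true]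
    refine and_congr_right fun _ => ⟨fun h u hu ha hlt => ?_, fun h u hu ha hlt => ?_⟩
    · have huB : u ∈ B := hB w hw u ha (by rintro rfl; linarith)
      rw [← ih u ⟨ha, hlt⟩ huB (hlt.le.trans hle)]
      exact h u ⟨hu, huB⟩ ha hlt
    · rw [ih u ⟨ha, hlt⟩ hu.2 (hlt.le.trans hle)]
      exact h u hu.1 ha hlt

theorem acceptedIn_congr (h : ∀ u ∈ U, x u = y u) :
    AcceptedIn G x U v ↔ AcceptedIn G y U v := by
  classical
  unfold AcceptedIn
  refine eventually_congr (Eventually.of_forall fun S => accepted_congr fun u hu => h u ?_)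
  exact (Finset.mem_filter.1 hu).2

theorem acceptedIn_mem (h : AcceptedIn G x U v) : v ∈ U := by
  classical
  obtain ⟨S, hS⟩ := h.exists
  rw [accepted_iff] at hS
  exact (Finset.mem_filter.1 hS.1).2

theorem measurableSet_acceptedIn [Countable V] (G : SimpleGraph V) (U : Set V) (v : V) :
    MeasurableSet {x : V → ℝ | AcceptedIn G x U v} := by
  classical
  have : {x : V → ℝ | AcceptedIn G x U v} = ⋃ S : Finset V, ⋂ S' : Finset V, ⋂ _ : S ⊆ S',
      {x | Accepted G x (S'.filter (· ∈ U)) v} := by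
    ext x
    simp [AcceptedIn, eventually_atTop]
  rw [this]
  exact MeasurableSet.iUnion fun S => MeasurableSet.iInter fun S' => MeasurableSet.iInter fun _ =>
    measurableSet_accepted G _ v

open Classical in
/-- The indicator that `v` is vacant just before time `t` in the process on `U`. -/
def vac (G : SimpleGraph V) (U : Set V) (v : V) (t : ℝ) (x : V → ℝ) : ℝ :=
  if x v < t ∧ AcceptedIn G x U v then 0 else 1

theorem vac_nonneg (t : ℝ) : 0 ≤ vac G U v t x := by
  unfold vac; split_ifs <;> simp

theorem vac_le_one (t : ℝ) : vac G U v t x ≤ 1 := by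
  unfold vac; split_ifs <;> simp

theorem vac_mul_self (t : ℝ) : vac G U v t x * vac G U v t x = vac G U v t x := by
  unfold vac; split_ifs <;> simp

theorem dependsOn_vac (t : ℝ) : DependsOn (vac G U v t) U := by
  intro x y h
  unfold vac
  by_cases hv : v ∈ U
  · rw [h v hv, acceptedIn_congr h]
  · rw [if_neg fun h => hv (acceptedIn_mem h.2), if_neg fun h => hv (acceptedIn_mem h.2)]

theorem measurable_vac [Countable V] (G : SimpleGraph V) (U : Set V) (v : V) :
    Measurable fun p : ℝ × (V → ℝ) => vac G U v p.1 p.2 := by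
  refine Measurable.ite (MeasurableSet.inter ?_ ?_) measurable_const measurable_const
  · exact measurableSet_lt ((measurable_pi_apply v).comp measurable_snd) measurable_fst
  · exact measurable_snd (measurableSet_acceptedIn G U v)

/-! ### Branches of a forest -/

/-- The vertices that can be reached from `c` without passing through `v`. -/
def branch (G : SimpleGraph V) (v c : V) : Set V :=
  {y | Relation.ReflTransGen (fun a b => G.Adj a b ∧ b ≠ v) c y}

theorem mem_branch_self : c ∈ branch G v c := Relation.ReflTransGen.refl

theorem mem_branch_of_adj (hy : w ∈ branch G v c) {z : V} (h : G.Adj w z) (hz : z ≠ v) :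
    z ∈ branch G v c :=
  Relation.ReflTransGen.tail hy ⟨h, hz⟩

theorem ne_of_mem_branch (hc : c ≠ v) (hw : w ∈ branch G v c) : w ≠ v := by
  rcases Relation.ReflTransGen.cases_tail hw with h | ⟨_, _, h⟩
  · exact h ▸ hc
  · exact h.2

/-- The edge from `v` to `c` is a bridge. If another branch shared `w`, one could go from `v` via
`c'` and `w` to `c` without that edge. -/
theorem eq_of_mem_branch (hG : G.IsAcyclic) {c' : V} (hc : G.Adj v c) (hc' : G.Adj v c')
    (hw : w ∈ branch G v c) (hw' : w ∈ branch G v c') : c = c' := by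
  by_contra hne
  have hbr := SimpleGraph.isAcyclic_iff_forall_adj_isBridge.1 hG hc
  rw [SimpleGraph.isBridge_iff] at hbr
  set H := G.deleteEdges {s(v, c)} with hH
  have step : ∀ d, d ≠ v → ∀ w, w ∈ branch G v d → H.Reachable d w := by
    intro d hd w hw
    induction hw with
    | refl => exact SimpleGraph.Reachable.refl _
    | @tail a b hab h ih =>
      refine ih.trans (SimpleGraph.Adj.reachable ?_)
      have ha : a ≠ v := ne_of_mem_branch hd hab
      rw [hH, SimpleGraph.deleteEdges_adj]
      refine ⟨h.1, fun h' => ?_⟩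
      have h2 := h.2
      simp only [Set.mem_singleton_iff, Sym2.eq_iff] at h'
      tauto
  have hvc' : H.Adj v c' := by
    rw [hH, SimpleGraph.deleteEdges_adj]
    refine ⟨hc', fun h' => ?_⟩
    simp only [Set.mem_singleton_iff, Sym2.eq_iff] at h'
    rcases h' with h | h
    · exact hne h.2.symm
    · exact hc.ne h.1
  exact hbr (hvc'.reachable.trans
    ((step c' hc'.ne' w hw').trans (step c hc.ne' w hw).symm))

theorem vac_branch (hG : ∀ v, (G.neighborSet v).Finite) (hx : WellFounded (Precedes G x))
    (hw : w ∈ branch G v c) :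
    vac G (U ∩ branch G v c) w (x v) x = vac G U w (x v) x := by
  unfold vac
  by_cases h : x w < x v
  · rw [acceptedIn_inter_iff hG hx (fun y hy z => mem_branch_of_adj hy) hw h.le]
  · simp [h]

/-- The neighbours of `v` in `U`. -/
def nbr (hG : ∀ v, (G.neighborSet v).Finite) (U : Set V) (v : V) : Finset V :=
  ((hG v).inter_of_left U).toFinset

theorem mem_nbr {hG : ∀ v, (G.neighborSet v).Finite} : w ∈ nbr hG U v ↔ G.Adj v w ∧ w ∈ U := by
  simp [nbr]

/-- At its own arrival time, `v` is accepted iff every neighbour is vacant, and up to then each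
branch can be run in isolation. The factors thus depend on disjoint sets of sites. -/
theorem prod_vac_branch (hG : ∀ v, (G.neighborSet v).Finite)
    (hx : WellFounded (Precedes G x)) (hv : v ∈ U) [Decidable (AcceptedIn G x U v)] :
    ∏ c ∈ nbr hG U v, vac G (U ∩ branch G v c) c (x v) x =
      if AcceptedIn G x U v then 1 else 0 := by
  rw [Finset.prod_congr rfl fun c _ => vac_branch hG hx mem_branch_self]
  have h := acceptedIn_iff hG hx (U := U) (v := v)
  split_ifs with ha
  · rw [h] at ha
    refine Finset.prod_eq_one fun c hc => ?_
    rw [mem_nbr] at hc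
    exact if_neg fun h' => ha.2 c hc.2 hc.1 h'.1 h'.2
  · rw [h] at ha
    push Not at ha
    obtain ⟨c, hc, hadj, hlt, hacc⟩ := ha hv
    exact Finset.prod_eq_zero (mem_nbr.2 ⟨hadj, hc⟩) (if_pos ⟨hlt, hacc⟩)

theorem vac_eq (hG : ∀ v, (G.neighborSet v).Finite) (hx : WellFounded (Precedes G x))
    (hv : v ∈ U) (t : ℝ) :
    vac G U v t x = 1 - if x v < t then
      ∏ c ∈ nbr hG U v, vac G (U ∩ branch G v c) c (x v) x else 0 := by
  classical
  rw [prod_vac_branch hG hx hv]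
  unfold vac
  by_cases h1 : x v < t <;> by_cases h2 : AcceptedIn G x U v <;> simp [h1, h2]

/-- The complement of "both vacant" splits by which site is occupied first: each subtracted term
says that one site is accepted before `t` while the other is vacant at that moment. -/
theorem vac_mul_vac (hG : ∀ v, (G.neighborSet v).Finite) (hx : WellFounded (Precedes G x))
    {d : V} (hv : v ∈ U) (hw : w ∈ U) (hne : x v ≠ x w) (hwc : w ∈ branch G v c)
    (hvd : v ∈ branch G w d) (t : ℝ) :
    vac G U v t x * vac G U w t x =
      1 - (if x v < t then (∏ c ∈ nbr hG U v, vac G (U ∩ branch G v c) c (x v) x) *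
            vac G (U ∩ branch G v c) w (x v) x else 0) -
        if x w < t then (∏ c ∈ nbr hG U w, vac G (U ∩ branch G w c) c (x w) x) *
            vac G (U ∩ branch G w d) v (x w) x else 0 := by
  classical
  rw [prod_vac_branch hG hx hv, prod_vac_branch hG hx hw, vac_branch hG hx hwc,
    vac_branch hG hx hvd]
  unfold vac
  rcases lt_or_gt_of_ne hne with h | h
  · by_cases h1 : x v < t <;> by_cases h2 : AcceptedIn G x U v <;>
      by_cases h3 : x w < t <;> by_cases h4 : AcceptedIn G x U w <;>
      simp [h1, h2, h3, h4, h, h.not_gt]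
    linarith
  · by_cases h1 : x v < t <;> by_cases h2 : AcceptedIn G x U v <;>
      by_cases h3 : x w < t <;> by_cases h4 : AcceptedIn G x U w <;>
      simp [h1, h2, h3, h4, h, h.not_gt]
    linarith

/-! ### Paths and degrees inside a branch -/

/-- `v` and `w` are joined by a path of length `m` inside `U`. -/
def Linked (G : SimpleGraph V) (U : Set V) (v w : V) (m : ℕ) : Prop :=
  ∃ p : G.Walk v w, p.IsPath ∧ p.length = m ∧ ∀ z ∈ p.support, z ∈ U

theorem Linked.symm {m : ℕ} (h : Linked G U v w m) : Linked G U w v m := by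
  obtain ⟨p, h1, h2, h3⟩ := h
  exact ⟨p.reverse, h1.reverse, by simpa using h2, by simpa using h3⟩

theorem Linked.eq_of_zero (h : Linked G U v w 0) : v = w := by
  obtain ⟨p, -, h2, -⟩ := h
  exact SimpleGraph.Walk.eq_of_length_eq_zero h2

theorem Linked.left_mem {m : ℕ} (h : Linked G U v w m) : v ∈ U := by
  obtain ⟨p, -, -, h3⟩ := h
  exact h3 v p.start_mem_support

theorem mem_branch_of_mem_support (p : G.Walk c w) (hp : v ∉ p.support) {z : V}
    (hz : z ∈ p.support) : z ∈ branch G v c := by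
  induction p with
  | nil =>
    rw [SimpleGraph.Walk.support_nil, List.mem_singleton] at hz
    exact hz ▸ mem_branch_self
  | cons h p ih =>
    rw [SimpleGraph.Walk.support_cons, List.mem_cons] at hp hz
    rcases hz with rfl | hz
    · exact mem_branch_self
    · refine Relation.ReflTransGen.head ⟨h, ?_⟩ (ih (fun h => hp (Or.inr h)) hz)
      rintro rfl
      exact hp (Or.inr p.start_mem_support)

theorem Linked.exists_step {m : ℕ} (h : Linked G U v w (m + 1)) :
    ∃ c, G.Adj v c ∧ c ∈ U ∧ w ∈ branch G v c ∧ v ≠ w ∧ Linked G (U ∩ branch G v c) c w m := by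
  obtain ⟨p, h1, h2, h3⟩ := h
  cases p with
  | nil => simp at h2
  | @cons _ c _ h p =>
    rw [SimpleGraph.Walk.cons_isPath_iff] at h1
    have hb := fun z => mem_branch_of_mem_support p h1.2 (z := z)
    have hU : ∀ z ∈ p.support, z ∈ U := fun z hz => h3 z (by simp [hz])
    refine ⟨c, h, hU c p.start_mem_support, hb w p.end_mem_support, ?_, p, h1.1, by simpa using h2,
      fun z hz => ⟨hU z hz, hb z hz⟩⟩
    rintro rfl
    exact h1.2 p.end_mem_support

open Classical in
/-- Every vertex of `U` has `k + 1` neighbours in `U`, except that `v` lacks `p` of them and `w`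
lacks `q` of them. -/
def NearlyRegular (hG : ∀ v, (G.neighborSet v).Finite) (k : ℕ) (U : Set V) (v w : V) (p q : ℕ) :
    Prop :=
  ∀ z ∈ U, (nbr hG U z).card + (if z = v then p else 0) + (if z = w then q else 0) = k + 1

theorem NearlyRegular.symm {hG : ∀ v, (G.neighborSet v).Finite} {k p q : ℕ}
    (h : NearlyRegular hG k U v w p q) : NearlyRegular hG k U w v q p := by
  intro z hz
  rw [← h z hz]
  ring

/-- A branch can be left only through `v`, and `c` is its only site adjacent to `v`. -/
theorem nbr_inter_branch {hG : ∀ v, (G.neighborSet v).Finite} (hA : G.IsAcyclic)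
    (hc : G.Adj v c) {z : V} (hz : z ∈ branch G v c) (hzc : z ≠ c) :
    nbr hG (U ∩ branch G v c) z = nbr hG U z := by
  ext u
  simp only [mem_nbr, Set.mem_inter_iff]
  refine ⟨fun h => ⟨h.1, h.2.1⟩, fun h => ⟨h.1, h.2, mem_branch_of_adj hz h.1 ?_⟩⟩
  rintro rfl
  exact hzc (eq_of_mem_branch hA h.1.symm hc mem_branch_self hz)

theorem card_nbr_inter_branch {hG : ∀ v, (G.neighborSet v).Finite}
    (hc : G.Adj v c) (hv : v ∈ U) :
    (nbr hG (U ∩ branch G v c) c).card + 1 = (nbr hG U c).card := by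
  classical
  have : nbr hG (U ∩ branch G v c) c = (nbr hG U c).erase v := by
    ext u
    simp only [mem_nbr, Set.mem_inter_iff, Finset.mem_erase]
    constructor
    · exact fun h => ⟨ne_of_mem_branch hc.ne' h.2.2, h.1, h.2.1⟩
    · exact fun h => ⟨h.2.1, h.2.2, mem_branch_of_adj mem_branch_self h.2.1 h.1⟩
  rw [this, Finset.card_erase_add_one (mem_nbr.2 ⟨hc.symm, hv⟩)]

theorem NearlyRegular.inter_branch {hG : ∀ v, (G.neighborSet v).Finite} {k p q : ℕ}
    (h : NearlyRegular hG k U v w p q) (hA : G.IsAcyclic) (hc : G.Adj v c) (hv : v ∈ U) :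
    NearlyRegular hG k (U ∩ branch G v c) c w 1 q := by
  intro z hz
  have hzv : z ≠ v := ne_of_mem_branch hc.ne' hz.2
  rw [← h z hz.1, if_neg hzv]
  by_cases hzc : z = c
  · subst hzc
    rw [← card_nbr_inter_branch hc hv, if_pos rfl]
  · rw [nbr_inter_branch hA hc hz.2 hzc, if_neg hzc]

/-- A branch missing `w` has one defect, at its root. Listing the root twice with defects `1` and
`0` is the encoding of a branch used throughout. -/
theorem NearlyRegular.inter_branch_of_notMem {hG : ∀ v, (G.neighborSet v).Finite} {k p q : ℕ}
    (h : NearlyRegular hG k U v w p q) (hA : G.IsAcyclic) (hc : G.Adj v c) (hv : v ∈ U)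
    (hw : w ∉ branch G v c) :
    NearlyRegular hG k (U ∩ branch G v c) c c 1 0 := by
  intro z hz
  rw [← h.inter_branch hA hc hv z hz, if_neg (c := z = w) (fun e : z = w => hw (e ▸ hz.2))]
  simp

end BlockingRSA

end

noncomputable section

namespace BlockingRSA

variable {V : Type*} {G : SimpleGraph V} {x y : V → ℝ} {U B : Set V} {v w c : V}

/-! ### Integrating over independent arrival times -/

section Independence

variable {Ω : Type*} [MeasurableSpace Ω] {P : Measure Ω} {τ : V → Ω → ℝ}

theorem IsArrivalTimes.measurable_config (hτ : IsArrivalTimes τ P) :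
    Measurable fun ω u => τ u ω :=
  measurable_pi_lambda _ hτ.measurable

/-- Setting the arrival times outside `U` to zero replaces restriction to `U` while staying on the
same configuration space. -/
theorem indicator_eq_of_dependsOn {β : Type*} {f : (V → ℝ) → β} (hf : DependsOn f U) (x : V → ℝ) :
    f (U.indicator x) = f x :=
  hf fun _ hu => Set.indicator_of_mem hu x

theorem IsArrivalTimes.indepFun_indicator (hτ : IsArrivalTimes τ P) {W : Set V}
    (hUW : Disjoint U W) :
    IndepFun (fun ω => U.indicator fun u => τ u ω) (fun ω => W.indicator fun u => τ u ω) P := by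
  have hle : ∀ U : Set V, MeasurableSpace.comap (fun ω => U.indicator fun u => τ u ω)
      MeasurableSpace.pi ≤ ⨆ i ∈ U, MeasurableSpace.comap (τ i) inferInstance := by
    intro U
    rw [← measurable_iff_comap_le]
    refine @measurable_pi_lambda _ _ _ (_) _ _ fun u => ?_
    by_cases hu : u ∈ U
    · simp only [Set.indicator_of_mem hu]
      exact (comap_measurable (τ u)).mono (le_iSup₂_of_le u hu le_rfl) le_rfl
    · simp only [Set.indicator_of_notMem hu]
      exact measurable_const
  have h := indep_iSup_of_disjoint (fun i => (hτ.measurable i).comap_le)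
    ((iIndepFun_iff_iIndep _ _ _).1 hτ.indep) hUW
  rw [IndepFun_iff_Indep]
  exact indep_of_indep_of_le_left (indep_of_indep_of_le_right h (hle W)) (hle U)

theorem IsArrivalTimes.indepFun (hτ : IsArrivalTimes τ P) {W : Set V} (hUW : Disjoint U W)
    {f g : (V → ℝ) → ℝ} (hf : Measurable f) (hg : Measurable g) (hfU : DependsOn f U)
    (hgW : DependsOn g W) :
    IndepFun (fun ω => f fun u => τ u ω) (fun ω => g fun u => τ u ω) P := by
  have h := (hτ.indepFun_indicator hUW).comp hf hg
  refine h.congr (Eventually.of_forall fun ω => ?_) (Eventually.of_forall fun ω => ?_)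
  · exact indicator_eq_of_dependsOn hfU _
  · exact indicator_eq_of_dependsOn hgW _

theorem IsArrivalTimes.integral_finsetProd (hτ : IsArrivalTimes τ P) [IsProbabilityMeasure P]
    {ι : Type*} (A : Finset ι) {f : ι → (V → ℝ) → ℝ} {W : ι → Set V}
    (hf : ∀ i ∈ A, Measurable (f i)) (hW : ∀ i ∈ A, DependsOn (f i) (W i))
    (hd : ∀ i ∈ A, ∀ j ∈ A, i ≠ j → Disjoint (W i) (W j)) :
    ∫ ω, ∏ i ∈ A, f i (fun u => τ u ω) ∂P = ∏ i ∈ A, ∫ ω, f i (fun u => τ u ω) ∂P := by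
  classical
  induction A using Finset.induction_on with
  | empty => simp
  | insert a A ha ih =>
    simp only [Finset.prod_insert ha]
    rw [← ih (fun i hi => hf i (Finset.mem_insert_of_mem hi))
      (fun i hi => hW i (Finset.mem_insert_of_mem hi))
      (fun i hi j hj => hd i (Finset.mem_insert_of_mem hi) j (Finset.mem_insert_of_mem hj))]
    have hm : Measurable fun x : V → ℝ => ∏ i ∈ A, f i x :=
      Finset.measurable_prod _ fun i hi => hf i (Finset.mem_insert_of_mem hi)
    have hma := hf a (Finset.mem_insert_self _ _)
    have hdep : DependsOn (fun x : V → ℝ => ∏ i ∈ A, f i x) (⋃ i ∈ A, W i) := by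
      intro x y h
      refine Finset.prod_congr rfl fun i hi => hW i (Finset.mem_insert_of_mem hi) fun u hu => h u ?_
      exact Set.mem_biUnion hi hu
    refine IndepFun.integral_fun_mul_eq_mul_integral
      (hτ.indepFun ?_ hma hm (hW a (Finset.mem_insert_self _ _)) hdep)
      (hma.comp hτ.measurable_config).aestronglyMeasurable
      (hm.comp hτ.measurable_config).aestronglyMeasurable
    rw [Set.disjoint_iUnion₂_right]
    intro i hi
    exact hd a (Finset.mem_insert_self _ _) i (Finset.mem_insert_of_mem hi)
      (by rintro rfl; exact ha hi)

theorem IsArrivalTimes.map_eq (hτ : IsArrivalTimes τ P) (v : V) :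
    P.map (τ v) = volume.restrict (Set.Ioo 0 1) := by
  rw [hτ.uniform v, ProbabilityTheory.cond]
  simp

/-- Conditioning on the arrival time of `v`: it is independent of all the other times, so Fubini
applies. -/
theorem IsArrivalTimes.integral_arrival (hτ : IsArrivalTimes τ P) [IsProbabilityMeasure P]
    (v : V) {f : ℝ × (V → ℝ) → ℝ} (hf : Measurable f) {C : ℝ} (hC : ∀ p, ‖f p‖ ≤ C)
    (hdep : ∀ s, DependsOn (fun x => f (s, x)) {v}ᶜ) :
    ∫ ω, f (τ v ω, fun u => τ u ω) ∂P =
      ∫ s in Set.Ioo (0 : ℝ) 1, ∫ ω, f (s, fun u => τ u ω) ∂P := by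
  set Y : Ω → V → ℝ := fun ω => ({v}ᶜ : Set V).indicator fun u => τ u ω with hY
  have hYm : Measurable Y := by
    refine measurable_pi_lambda _ fun u => ?_
    by_cases hu : u ∈ ({v}ᶜ : Set V)
    · simp only [hY, Set.indicator_of_mem hu]; exact hτ.measurable u
    · simp only [hY, Set.indicator_of_notMem hu]; exact measurable_const
  have hfY : ∀ s ω, f (s, fun u => τ u ω) = f (s, Y ω) := fun s ω =>
    (indicator_eq_of_dependsOn (hdep s) _).symm
  have hind : IndepFun (τ v) Y P := by
    have h := (hτ.indepFun_indicator (U := {v}) (W := {v}ᶜ) disjoint_compl_right).comp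
      (measurable_pi_apply v) measurable_id
    refine h.congr (Eventually.of_forall fun ω => ?_) (Eventually.of_forall fun ω => rfl)
    simp
  have hmap := hind.map_prod_eq_prod_map_map (hτ.measurable v).aemeasurable hYm.aemeasurable
  have : IsProbabilityMeasure (P.map Y) := Measure.isProbabilityMeasure_map hYm.aemeasurable
  have : IsProbabilityMeasure (P.map (τ v)) :=
    Measure.isProbabilityMeasure_map (hτ.measurable v).aemeasurable
  simp only [hfY]
  calc ∫ ω, f (τ v ω, Y ω) ∂P = ∫ p, f p ∂(P.map fun ω => (τ v ω, Y ω)) :=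
        (integral_map ((hτ.measurable v).prodMk hYm).aemeasurable hf.aestronglyMeasurable).symm
    _ = ∫ s, ∫ y, f (s, y) ∂(P.map Y) ∂(P.map (τ v)) := by
        rw [hmap, MeasureTheory.integral_prod]
        exact Integrable.of_bound hf.aestronglyMeasurable C (Eventually.of_forall hC)
    _ = _ := by
        rw [hτ.map_eq v]
        refine integral_congr_ae (Eventually.of_forall fun s => ?_)
        exact integral_map hYm.aemeasurable
          (hf.comp measurable_prodMk_left).aestronglyMeasurable

theorem IsArrivalTimes.measurable_integral (hτ : IsArrivalTimes τ P) [IsProbabilityMeasure P]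
    {f : ℝ × (V → ℝ) → ℝ} (hf : Measurable f) :
    Measurable fun s => ∫ ω, f (s, fun u => τ u ω) ∂P :=
  (StronglyMeasurable.integral_prod_right' (f := fun p : ℝ × Ω => f (p.1, fun u => τ u p.2))
    (hf.comp (measurable_fst.prodMk
      (hτ.measurable_config.comp measurable_snd))).stronglyMeasurable).measurable

theorem IsArrivalTimes.integral_arrival_lt (hτ : IsArrivalTimes τ P) [IsProbabilityMeasure P]
    (v : V) {f : ℝ × (V → ℝ) → ℝ} (hf : Measurable f) {C : ℝ} (hC : ∀ p, ‖f p‖ ≤ C)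
    (hdep : ∀ s, DependsOn (fun x => f (s, x)) {v}ᶜ) {t : ℝ} (ht : t ∈ Set.Icc (0 : ℝ) 1) :
    ∫ ω, (if τ v ω < t then f (τ v ω, fun u => τ u ω) else 0) ∂P =
      ∫ s in (0 : ℝ)..t, ∫ ω, f (s, fun u => τ u ω) ∂P := by
  have hC0 : 0 ≤ C := (norm_nonneg _).trans (hC (0, 0))
  have h := hτ.integral_arrival v (f := fun p => if p.1 < t then f p else 0)
    (Measurable.ite (measurableSet_lt measurable_fst measurable_const) hf measurable_const)
    (C := C) (fun p => by split_ifs; exacts [hC p, by simpa using hC0])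
    (fun s => by
      by_cases hs : s < t
      · simpa [hs] using hdep s
      · simpa [hs] using (dependsOn_const (0 : ℝ)).mono (Set.empty_subset _))
  rw [h]
  have h2 : ∀ s, ∫ ω, (if s < t then f (s, fun u => τ u ω) else 0) ∂P =
      (Set.Iio t).indicator (fun s => ∫ ω, f (s, fun u => τ u ω) ∂P) s := by
    intro s
    by_cases hs : s < t <;> simp [hs]
  simp only [h2]
  rw [setIntegral_indicator measurableSet_Iio, intervalIntegral.integral_of_le ht.1,
    integral_Ioc_eq_integral_Ioo]
  congr 2
  ext s
  simp only [Set.mem_inter_iff, Set.mem_Ioo, Set.mem_Iio]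
  exact ⟨fun h => ⟨h.1.1, h.2⟩, fun h => ⟨⟨h.1, h.2.trans_le ht.2⟩, h.2⟩⟩

theorem IsArrivalTimes.ae_ne (hτ : IsArrivalTimes τ P) (v : V) (t : ℝ) : ∀ᵐ ω ∂P, τ v ω ≠ t := by
  have h : ∀ᵐ s ∂(P.map (τ v)), s ≠ t := by
    rw [hτ.map_eq v]
    exact ae_restrict_of_ae (Measure.ae_ne volume t)
  exact ae_of_ae_map (hτ.measurable v).aemeasurable h

theorem IsArrivalTimes.ae_mem (hτ : IsArrivalTimes τ P) (v : V) :
    ∀ᵐ ω ∂P, τ v ω ∈ Set.Ioo (0 : ℝ) 1 := by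
  have h : ∀ᵐ s ∂(P.map (τ v)), s ∈ Set.Ioo (0 : ℝ) 1 := by
    rw [hτ.map_eq v]
    exact ae_restrict_mem measurableSet_Ioo
  exact ae_of_ae_map (hτ.measurable v).aemeasurable h

theorem IsArrivalTimes.ae_ne_of_ne (hτ : IsArrivalTimes τ P) [IsProbabilityMeasure P]
    (hvw : v ≠ w) : ∀ᵐ ω ∂P, τ v ω ≠ τ w ω := by
  classical
  have hms : MeasurableSet {ω | τ v ω = τ w ω} :=
    measurableSet_eq_fun (hτ.measurable v) (hτ.measurable w)
  have hmf : Measurable fun p : ℝ × (V → ℝ) => if p.1 = p.2 w then (1 : ℝ) else 0 :=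
    Measurable.ite (measurableSet_eq_fun measurable_fst
      ((measurable_pi_apply w).comp measurable_snd)) measurable_const measurable_const
  have h := hτ.integral_arrival v hmf (C := 1) (fun p => by split_ifs <;> simp)
    (fun s x y h => by simp only [h w (by simpa using hvw.symm)])
  have h0 : ∀ s, ∫ ω, (if s = τ w ω then (1 : ℝ) else 0) ∂P = 0 := by
    intro s
    refine integral_eq_zero_of_ae ?_
    filter_upwards [hτ.ae_ne w s] with ω hω
    simp [hω.symm]
  simp only [h0, integral_zero] at h
  have h1 : P.real {ω | τ v ω = τ w ω} = 0 := by
    rw [← h, ← integral_indicator_one hms]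
    refine integral_congr_ae (Eventually.of_forall fun ω => ?_)
    simp [Set.indicator_apply]
  rw [ae_iff]
  simpa using (measureReal_eq_zero_iff (by finiteness)).1 h1

end Independence

end BlockingRSA

end

noncomputable section

namespace BlockingRSA

variable {V : Type*} {G : SimpleGraph V} {x y : V → ℝ} {U B : Set V} {v w c : V}

/-! ### Almost surely there are no infinite chains of earlier neighbours -/

/-- There is a path in `U` of `n` sites starting at `v` along which the arrival times
decrease, the first of them being less than `t`. -/
def Descent (G : SimpleGraph V) : ℕ → Set V → V → ℝ → (V → ℝ) → Prop
  | 0, _, _, _, _ => True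
  | n + 1, U, v, t, x => v ∈ U ∧ x v < t ∧ ∃ c, G.Adj v c ∧ Descent G n (U \ {v}) c (x v) x

theorem dependsOn_descent (n : ℕ) (t : ℝ) : DependsOn (Descent G n U v t) U := by
  induction n generalizing U v t with
  | zero => intro x y _; rfl
  | succ n ih =>
    intro x y h
    unfold Descent
    rw [eq_iff_iff]
    refine and_congr_right fun hv => ?_
    rw [h v hv]
    refine and_congr_right fun _ => exists_congr fun c => and_congr_right fun _ => ?_
    rw [ih (y v) (fun u hu => h u hu.1)]

theorem measurableSet_descent [Countable V] (n : ℕ) (U : Set V) (v : V) :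
    MeasurableSet {p : ℝ × (V → ℝ) | Descent G n U v p.1 p.2} := by
  induction n generalizing U v with
  | zero => simp [Descent]
  | succ n ih =>
    have : {p : ℝ × (V → ℝ) | Descent G (n + 1) U v p.1 p.2} =
        {_p | v ∈ U} ∩ ({p | p.2 v < p.1} ∩ ⋃ c, {_p | G.Adj v c} ∩
          (fun p : ℝ × (V → ℝ) => (p.2 v, p.2)) ⁻¹'
            {p : ℝ × (V → ℝ) | Descent G n (U \ {v}) c p.1 p.2}) := by
      ext p
      simp [Descent]
    rw [this]
    have hm : Measurable fun p : ℝ × (V → ℝ) => p.2 v := (measurable_pi_apply v).comp measurable_snd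
    exact (MeasurableSet.const _).inter ((measurableSet_lt hm measurable_fst).inter
      (MeasurableSet.iUnion fun c => (MeasurableSet.const _).inter
        ((hm.prodMk measurable_snd) (ih _ c))))

theorem descent_of_chain {f : ℕ → V} (hf : ∀ n, Precedes G x (f (n + 1)) (f n)) (n i : ℕ) {t : ℝ}
    (ht : x (f i) < t) (hU : ∀ j, i ≤ j → f j ∈ U) : Descent G n U (f i) t x := by
  have hanti : StrictAnti fun n => x (f n) := strictAnti_nat_of_succ_lt fun n => (hf n).2
  induction n generalizing U i t with
  | zero => trivial
  | succ n ih =>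
    refine ⟨hU i le_rfl, ht, f (i + 1), (hf i).1, ih (i + 1) (hf i).2 fun j hj => ?_⟩
    refine ⟨hU j (by omega), fun h => ?_⟩
    -- Strictly decreasing times prevent the chain from returning to a site.
    have := hanti (show i < j by omega)
    simp only [Set.mem_singleton_iff] at h
    simp [h] at this

section Probability

variable {Ω : Type*} [MeasurableSpace Ω] {P : Measure Ω} [IsProbabilityMeasure P] {τ : V → Ω → ℝ}

open Classical in
-- A union bound over the at most `D` next sites, conditioned on the arrival at `v`, gives the bound
-- `n + 1` as the integral of `D` times the bound `n`.
theorem IsArrivalTimes.integral_descent_le [Countable V] (hτ : IsArrivalTimes τ P)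
    (hG : ∀ v, (G.neighborSet v).Finite) {D : ℕ} (hD : ∀ v, (nbr hG Set.univ v).card ≤ D)
    (n : ℕ) (U : Set V) (v : V) {t : ℝ} (ht : t ∈ Set.Icc (0 : ℝ) 1) :
    ∫ ω, (if Descent G n U v t (fun u => τ u ω) then (1 : ℝ) else 0) ∂P ≤
      (D * t) ^ n / n.factorial := by
  induction n generalizing U v t with
  | zero => simp [Descent]
  | succ n ih =>
    have hmeas : ∀ c, Measurable fun p : ℝ × (V → ℝ) =>
        if Descent G n (U \ {v}) c p.1 p.2 then (1 : ℝ) else 0 := fun c =>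
      Measurable.ite (measurableSet_descent n _ c) measurable_const measurable_const
    have hint : ∀ c s, Integrable (fun ω =>
        if Descent G n (U \ {v}) c s (fun u => τ u ω) then (1 : ℝ) else 0) P := fun c s =>
      Integrable.of_bound (((hmeas c).comp measurable_prodMk_left).comp
        hτ.measurable_config).aestronglyMeasurable 1
        (Eventually.of_forall fun ω => by dsimp; split_ifs <;> simp)
    set g : ℝ × (V → ℝ) → ℝ := fun p => ∑ c ∈ nbr hG Set.univ v,
      if Descent G n (U \ {v}) c p.1 p.2 then (1 : ℝ) else 0 with hg
    have hgm : Measurable g := Finset.measurable_sum _ fun c _ => hmeas c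
    have hg0 : ∀ p, 0 ≤ g p := fun p => Finset.sum_nonneg fun c _ => by split_ifs <;> simp
    have hgD : ∀ p, ‖g p‖ ≤ D := by
      intro p
      rw [Real.norm_of_nonneg (hg0 p)]
      refine (Finset.sum_le_card_nsmul _ _ 1 fun c _ => by split_ifs <;> simp).trans ?_
      simpa using hD v
    have hgi : ∀ s, ∫ ω, g (s, fun u => τ u ω) ∂P = ∑ c ∈ nbr hG Set.univ v,
        ∫ ω, (if Descent G n (U \ {v}) c s (fun u => τ u ω) then (1 : ℝ) else 0) ∂P := fun s =>
      integral_finsetSum _ fun c _ => hint c s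
    calc ∫ ω, (if Descent G (n + 1) U v t (fun u => τ u ω) then (1 : ℝ) else 0) ∂P
        ≤ ∫ ω, (if τ v ω < t then g (τ v ω, fun u => τ u ω) else 0) ∂P := by
          refine integral_mono_of_nonneg (Eventually.of_forall fun ω => ?_)
            (Integrable.of_bound (Measurable.ite (measurableSet_lt (hτ.measurable v)
              measurable_const) (hgm.comp ((hτ.measurable v).prodMk hτ.measurable_config))
              measurable_const).aestronglyMeasurable D (Eventually.of_forall fun ω => ?_))
            (Eventually.of_forall fun ω => ?_)
          · dsimp; split_ifs <;> simp
          · split_ifs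
            · exact hgD _
            · simp
          · dsimp only
            split_ifs with h1 h2 h2
            · obtain ⟨-, -, c, hc, hd⟩ := h1
              refine le_trans ?_ (Finset.single_le_sum (f := fun c =>
                if Descent G n (U \ {v}) c (τ v ω) (fun u => τ u ω) then (1 : ℝ) else 0)
                (fun c _ => by split_ifs <;> simp) (mem_nbr.2 ⟨hc, Set.mem_univ c⟩))
              simp [hd]
            · exact absurd h1.2.1 h2
            · exact hg0 _
            · exact le_rfl
      _ = ∫ s in (0 : ℝ)..t, ∫ ω, g (s, fun u => τ u ω) ∂P := by
          refine hτ.integral_arrival_lt v hgm hgD (fun s x y h => ?_) ht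
          -- The rest of the path avoids `v`, so its event ignores the arrival time being integrated
          -- out.
          refine Finset.sum_congr rfl fun c _ => ?_
          simp only
          rw [dependsOn_descent n s fun u hu => h u hu.2]
      _ ≤ ∫ s in (0 : ℝ)..t, D * ((D * s) ^ n / n.factorial) := by
          refine intervalIntegral.integral_mono_on ht.1 ?_ ?_ fun s hs => ?_
          · rw [intervalIntegrable_iff]
            refine Measure.integrableOn_of_bounded (M := D) (by simp)
              (hτ.measurable_integral hgm).aestronglyMeasurable (Eventually.of_forall fun s => ?_)
            refine (norm_integral_le_of_norm_le_const (Eventually.of_forall fun ω => hgD _)).trans ?_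
            simp
          · exact (by fun_prop : Continuous fun s : ℝ =>
              (D : ℝ) * ((D * s) ^ n / n.factorial)).intervalIntegrable _ _
          · rw [hgi]
            have hb := fun c => ih (U \ {v}) c (t := s) ⟨hs.1, hs.2.trans ht.2⟩
            refine (Finset.sum_le_card_nsmul _ _ _ fun c _ => hb c).trans ?_
            rw [nsmul_eq_mul]
            have : (0 : ℝ) ≤ (D * s) ^ n / n.factorial := by have := hs.1; positivity
            gcongr
            exact hD v
      _ = (D * t) ^ (n + 1) / (n + 1).factorial := by
          have : ∀ s : ℝ, (D : ℝ) * ((D * s) ^ n / n.factorial) =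
              ((D : ℝ) ^ (n + 1) / n.factorial) * s ^ n := fun s => by ring
          simp only [this]
          rw [intervalIntegral.integral_const_mul, integral_pow, Nat.factorial_succ]
          push_cast
          field_simp
          simp [mul_pow]

theorem IsArrivalTimes.ae_wellFounded [Countable V] (hτ : IsArrivalTimes τ P)
    (hG : ∀ v, (G.neighborSet v).Finite) {D : ℕ} (hD : ∀ v, (nbr hG Set.univ v).card ≤ D) :
    ∀ᵐ ω ∂P, WellFounded (Precedes G fun u => τ u ω) := by
  classical
  have h1 : ∀ v, ∀ᵐ ω ∂P, ∃ n, ¬ Descent G n Set.univ v 1 (fun u => τ u ω) := by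
    intro v
    have hms : ∀ n, MeasurableSet {ω | Descent G n Set.univ v 1 (fun u => τ u ω)} := fun n =>
      (measurable_const.prodMk hτ.measurable_config) (measurableSet_descent n Set.univ v)
    have hle : ∀ n : ℕ, P.real {ω | ∀ n, Descent G n Set.univ v 1 (fun u => τ u ω)} ≤
        (D : ℝ) ^ n / n.factorial := by
      intro n
      have h := hτ.integral_descent_le hG hD n Set.univ v (t := 1) (by simp)
      rw [mul_one] at h
      refine le_trans ?_ h
      refine (measureReal_mono (s₂ := {ω | Descent G n Set.univ v 1 (fun u => τ u ω)})
        (by intro ω hω; simp only [Set.mem_ofPred_eq] at hω ⊢; exact hω n)).trans_eq ?_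
      rw [← integral_indicator_one (hms n)]
      refine integral_congr_ae (Eventually.of_forall fun ω => ?_)
      simp [Set.indicator_apply]
    have h0 := ge_of_tendsto' (FloorSemiring.tendsto_pow_div_factorial_atTop (D : ℝ)) hle
    rw [ae_iff]
    simpa using (measureReal_eq_zero_iff (by finiteness)).1
      (le_antisymm h0 measureReal_nonneg)
  filter_upwards [ae_all_iff.2 h1, ae_all_iff.2 hτ.ae_mem] with ω hω hlt
  rw [wellFounded_iff_isEmpty_descending_chain]
  refine ⟨fun ⟨f, hf⟩ => ?_⟩
  obtain ⟨n, hn⟩ := hω (f 0)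
  exact hn (descent_of_chain hf n 0 (hlt _).2 fun _ _ => Set.mem_univ _)

/-! ### Integral equations for vacancy probabilities -/

/-- The probability that `v` is vacant at time `t` in the process on `U`. -/
def vacProb (G : SimpleGraph V) (τ : V → Ω → ℝ) (P : Measure Ω) (U : Set V) (v : V) (t : ℝ) : ℝ :=
  ∫ ω, vac G U v t (fun u => τ u ω) ∂P

/-- The probability that `v` and `w` are vacant at time `t` in the process on `U`. -/
def vacProb₂ (G : SimpleGraph V) (τ : V → Ω → ℝ) (P : Measure Ω) (U : Set V) (v w : V) (t : ℝ) :
    ℝ :=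
  ∫ ω, vac G U v t (fun u => τ u ω) * vac G U w t (fun u => τ u ω) ∂P

theorem measurable_vac_right [Countable V] (t : ℝ) : Measurable (vac G U v t) :=
  (measurable_vac G U v).comp measurable_prodMk_left

theorem vacProb_mem (U : Set V) (v : V) (t : ℝ) : vacProb G τ P U v t ∈ Set.Icc (0 : ℝ) 1 := by
  refine ⟨integral_nonneg fun ω => vac_nonneg t, ?_⟩
  refine (integral_mono_of_nonneg (Eventually.of_forall fun ω => vac_nonneg t)
    (integrable_const 1) (Eventually.of_forall fun ω => vac_le_one t)).trans_eq (by simp)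

theorem IsArrivalTimes.measurable_vacProb [Countable V] (hτ : IsArrivalTimes τ P) (U : Set V)
    (v : V) : Measurable (vacProb G τ P U v) :=
  hτ.measurable_integral (measurable_vac G U v)

theorem norm_prod_vac_le (A : Finset V) (B : V → Set V) (t : ℝ) (x : V → ℝ) :
    ‖∏ c ∈ A, vac G (B c) c t x‖ ≤ 1 := by
  rw [Real.norm_of_nonneg (Finset.prod_nonneg fun c _ => vac_nonneg t)]
  exact Finset.prod_le_one (fun c _ => vac_nonneg t) fun c _ => vac_le_one t

theorem disjoint_inter_branch (hA : G.IsAcyclic) {c' : V} (hc : G.Adj v c) (hc' : G.Adj v c')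
    (hne : c ≠ c') : Disjoint (U ∩ branch G v c) (U ∩ branch G v c') := by
  rw [Set.disjoint_left]
  exact fun z hz hz' => hne (eq_of_mem_branch hA hc hc' hz.2 hz'.2)

theorem inter_branch_subset_compl (hc : G.Adj v c) : U ∩ branch G v c ⊆ {v}ᶜ :=
  fun _ hz => ne_of_mem_branch hc.ne' hz.2

theorem IsArrivalTimes.vacProb_eq [Countable V] (hτ : IsArrivalTimes τ P)
    (hG : ∀ v, (G.neighborSet v).Finite) (hA : G.IsAcyclic)
    (hwf : ∀ᵐ ω ∂P, WellFounded (Precedes G fun u => τ u ω)) (hv : v ∈ U)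
    {t : ℝ} (ht : t ∈ Set.Icc (0 : ℝ) 1) :
    vacProb G τ P U v t = 1 - ∫ s in (0 : ℝ)..t,
      ∏ c ∈ nbr hG U v, vacProb G τ P (U ∩ branch G v c) c s := by
  set f : ℝ × (V → ℝ) → ℝ := fun p => ∏ c ∈ nbr hG U v, vac G (U ∩ branch G v c) c p.1 p.2 with hf
  have hfm : Measurable f := Finset.measurable_prod _ fun c _ => measurable_vac G _ c
  have h := hτ.integral_arrival_lt v hfm (C := 1) (fun p => norm_prod_vac_le _ _ _ _)
    (fun s x y h => Finset.prod_congr rfl fun c hc => dependsOn_vac s fun u hu =>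
      h u (inter_branch_subset_compl (mem_nbr.1 hc).1 hu)) ht
  have h2 : ∀ s, ∫ ω, f (s, fun u => τ u ω) ∂P =
      ∏ c ∈ nbr hG U v, vacProb G τ P (U ∩ branch G v c) c s := fun s =>
    hτ.integral_finsetProd _ (fun c _ => measurable_vac_right s) (fun c _ => dependsOn_vac s)
      fun c hc c' hc' hne =>
        disjoint_inter_branch hA (mem_nbr.1 hc).1 (mem_nbr.1 hc').1 hne
  simp only [← h2]
  rw [← h]
  have hi : Integrable (fun ω => if τ v ω < t then f (τ v ω, fun u => τ u ω) else 0) P := by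
    refine Integrable.of_bound (Measurable.ite (measurableSet_lt (hτ.measurable v)
      measurable_const) (hfm.comp ((hτ.measurable v).prodMk hτ.measurable_config))
      measurable_const).aestronglyMeasurable 1 (Eventually.of_forall fun ω => ?_)
    split_ifs
    · exact norm_prod_vac_le _ _ _ _
    · simp
  rw [← show ∫ _ : Ω, (1 : ℝ) ∂P = 1 by simp, ← integral_sub (integrable_const _) hi]
  refine integral_congr_ae ?_
  filter_upwards [hwf] with ω hω
  exact vac_eq hG hω hv t

theorem IsArrivalTimes.integral_arrival_pair [Countable V] [DecidableEq V] (hτ : IsArrivalTimes τ P)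
    (hG : ∀ v, (G.neighborSet v).Finite) (hA : G.IsAcyclic) (hc : G.Adj v c) (hcU : c ∈ U)
    {t : ℝ} (ht : t ∈ Set.Icc (0 : ℝ) 1) :
    Integrable (fun ω => if τ v ω < t then
      (∏ c ∈ nbr hG U v, vac G (U ∩ branch G v c) c (τ v ω) (fun u => τ u ω)) *
        vac G (U ∩ branch G v c) w (τ v ω) (fun u => τ u ω) else 0) P ∧
    ∫ ω, (if τ v ω < t then
      (∏ c ∈ nbr hG U v, vac G (U ∩ branch G v c) c (τ v ω) (fun u => τ u ω)) *
        vac G (U ∩ branch G v c) w (τ v ω) (fun u => τ u ω) else 0) ∂P =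
      ∫ s in (0 : ℝ)..t, vacProb₂ G τ P (U ∩ branch G v c) c w s *
        ∏ c ∈ (nbr hG U v).erase c, vacProb G τ P (U ∩ branch G v c) c s := by
  have hcn : c ∈ nbr hG U v := mem_nbr.2 ⟨hc, hcU⟩
  set f : ℝ × (V → ℝ) → ℝ := fun p =>
    (∏ c ∈ nbr hG U v, vac G (U ∩ branch G v c) c p.1 p.2) *
      vac G (U ∩ branch G v c) w p.1 p.2 with hf
  have hfm : Measurable f :=
    (Finset.measurable_prod _ fun c _ => measurable_vac G _ c).mul (measurable_vac G _ w)
  have hb : ∀ p, ‖f p‖ ≤ 1 := fun p => by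
    rw [hf, norm_mul, Real.norm_of_nonneg (vac_nonneg _)]
    exact mul_le_one₀ (norm_prod_vac_le _ _ _ _) (vac_nonneg _) (vac_le_one _)
  have h := hτ.integral_arrival_lt v hfm hb (fun s x y h => by
      simp only [hf]
      congr 1
      · exact Finset.prod_congr rfl fun c hc => dependsOn_vac s fun u hu =>
          h u (inter_branch_subset_compl (mem_nbr.1 hc).1 hu)
      · exact dependsOn_vac s fun u hu => h u (inter_branch_subset_compl hc hu)) ht
  refine ⟨?_, ?_⟩
  · refine Integrable.of_bound (Measurable.ite (measurableSet_lt (hτ.measurable v)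
      measurable_const) (hfm.comp ((hτ.measurable v).prodMk hτ.measurable_config))
      measurable_const).aestronglyMeasurable 1 (Eventually.of_forall fun ω => ?_)
    split_ifs
    · exact hb (τ v ω, fun u => τ u ω)
    · simp
  · rw [h]
    congr 1
    funext s
    -- The factor of `w` lives in the branch of `c`, so it is absorbed into the factor of `c`; the
    -- factors are then independent.
    set g : V → (V → ℝ) → ℝ := fun d x => if d = c then
      vac G (U ∩ branch G v c) c s x * vac G (U ∩ branch G v c) w s x else
      vac G (U ∩ branch G v d) d s x with hg
    have hgc : ∀ x, g c x =
        vac G (U ∩ branch G v c) c s x * vac G (U ∩ branch G v c) w s x := fun x => by simp [hg]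
    have hgd : ∀ d, d ≠ c → ∀ x, g d x = vac G (U ∩ branch G v d) d s x := fun d hd x => by
      simp [hg, hd]
    have hfg : ∀ x, f (s, x) = ∏ d ∈ nbr hG U v, g d x := by
      intro x
      simp only [hf]
      rw [← Finset.mul_prod_erase _ (fun d => vac G (U ∩ branch G v d) d s x) hcn, ← Finset.mul_prod_erase _ (fun d => g d x) hcn, hgc,
        Finset.prod_congr rfl fun d hd => hgd d (Finset.ne_of_mem_erase hd) x]
      ring
    simp only [hfg]
    rw [hτ.integral_finsetProd (f := g) (W := fun d => U ∩ branch G v d)]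
    · rw [← Finset.mul_prod_erase _ _ hcn]
      simp only [hgc]
      congr 1
      refine Finset.prod_congr rfl fun d hd => ?_
      simp only [hgd d (Finset.ne_of_mem_erase hd)]
      rfl
    · intro d _
      by_cases hd : d = c
      · subst hd
        simp only [hg, if_true]
        exact (measurable_vac_right s).mul (measurable_vac_right s)
      · simp only [hg, hd, if_false]
        exact measurable_vac_right s
    · intro d _ x y hxy
      by_cases hd : d = c
      · subst hd
        rw [hgc, hgc, dependsOn_vac s hxy, dependsOn_vac s hxy]
      · rw [hgd d hd, hgd d hd, dependsOn_vac s hxy]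
    · exact fun d hd d' hd' hne =>
        disjoint_inter_branch hA (mem_nbr.1 hd).1 (mem_nbr.1 hd').1 hne

theorem IsArrivalTimes.vacProb₂_eq [Countable V] [DecidableEq V] (hτ : IsArrivalTimes τ P)
    (hG : ∀ v, (G.neighborSet v).Finite) (hA : G.IsAcyclic)
    (hwf : ∀ᵐ ω ∂P, WellFounded (Precedes G fun u => τ u ω)) {d : V} (hv : v ∈ U) (hw : w ∈ U)
    (hvw : v ≠ w) (hc : G.Adj v c) (hcU : c ∈ U) (hwc : w ∈ branch G v c) (hd : G.Adj w d)
    (hdU : d ∈ U) (hvd : v ∈ branch G w d) {t : ℝ} (ht : t ∈ Set.Icc (0 : ℝ) 1) :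
    vacProb₂ G τ P U v w t = 1 -
      (∫ s in (0 : ℝ)..t, vacProb₂ G τ P (U ∩ branch G v c) c w s *
        ∏ c ∈ (nbr hG U v).erase c, vacProb G τ P (U ∩ branch G v c) c s) -
      ∫ s in (0 : ℝ)..t, vacProb₂ G τ P (U ∩ branch G w d) d v s *
        ∏ c ∈ (nbr hG U w).erase d, vacProb G τ P (U ∩ branch G w c) c s := by
  obtain ⟨hi1, h1⟩ := hτ.integral_arrival_pair (w := w) hG hA hc hcU ht
  obtain ⟨hi2, h2⟩ := hτ.integral_arrival_pair (w := v) hG hA hd hdU ht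
  have hi3 := (integrable_const (μ := P) (1 : ℝ)).sub hi1
  rw [← h1, ← h2, ← show ∫ _ : Ω, (1 : ℝ) ∂P = 1 by simp,
    ← integral_sub (integrable_const _) hi1]
  refine Eq.trans ?_ (integral_sub hi3 hi2)
  refine integral_congr_ae ?_
  filter_upwards [hwf, hτ.ae_ne_of_ne hvw] with ω hω hne
  exact vac_mul_vac hG hω hv hw hne hwc hvd t

end Probability

end BlockingRSA

end

noncomputable section

namespace BlockingRSA

/-! ### Closed forms for the vacancy probabilities of pairs -/

/-- The Taylor polynomial of degree `m` of the exponential function. -/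
def expPartial (m : ℕ) (y : ℝ) : ℝ := ∑ i ∈ Finset.range (m + 1), y ^ i / i.factorial

/-- The sum of the terms of degree `m + 1, m + 3, m + 5, …` of the exponential series. -/
def expTail : ℕ → ℝ → ℝ
  | 0, y => Real.sinh y
  | 1, y => Real.cosh y - 1
  | m + 2, y => expTail m y - y ^ (m + 1) / (m + 1).factorial

theorem hasSum_expTail (m : ℕ) (y : ℝ) :
    HasSum (fun n : ℕ => y ^ (m + 1 + 2 * n) / ((m + 1 + 2 * n).factorial : ℝ)) (expTail m y) := by
  induction m using Nat.twoStepInduction with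
  | zero =>
    simpa only [expTail, zero_add, add_comm 1] using Real.hasSum_sinh y
  | one =>
    have h := (hasSum_nat_add_iff' 1).2 (Real.hasSum_cosh y)
    simp only [Finset.sum_range_one, mul_zero, pow_zero, Nat.factorial_zero, Nat.cast_one,
      div_one, mul_add, mul_one] at h
    simpa only [expTail, Nat.reduceAdd, add_comm 2] using h
  | more m ih _ =>
    have h := (hasSum_nat_add_iff' 1).2 ih
    simp only [Finset.sum_range_one, mul_zero, add_zero] at h
    rw [expTail]
    refine h.congr_fun fun n => ?_
    rw [show m + 2 + 1 + 2 * n = m + 1 + 2 * (n + 1) by ring]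

theorem expTail_zero_right (m : ℕ) : expTail m 0 = 0 := by
  refine (hasSum_expTail m 0).unique ?_
  convert hasSum_zero using 2 with n
  rw [zero_pow (by omega), zero_div]

theorem expPartial_zero_right (m : ℕ) : expPartial m 0 = 1 := by
  rw [expPartial, Finset.sum_range_succ']
  simp

theorem expPartial_succ (m : ℕ) (y : ℝ) :
    expPartial (m + 1) y = expPartial m y + y ^ (m + 1) / (m + 1).factorial :=
  Finset.sum_range_succ _ _

/-- The two tails take alternate terms of the remainder of the exponential series. -/
theorem expTail_add_expTail_succ (m : ℕ) (y : ℝ) :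
    expTail m y + expTail (m + 1) y = Real.exp y - expPartial m y := by
  induction m with
  | zero =>
    simp only [expTail, expPartial]
    rw [← Real.cosh_add_sinh]
    simp only [zero_add, Finset.sum_range_one, pow_zero, Nat.factorial_zero, Nat.cast_one, div_one]
    ring
  | succ m ih =>
    rw [expPartial_succ, expTail]
    linarith

theorem hasDerivAt_pow_div_factorial (m : ℕ) (y : ℝ) :
    HasDerivAt (fun y : ℝ => y ^ (m + 1) / ((m + 1).factorial : ℝ)) (y ^ m / m.factorial) y := by
  refine ((hasDerivAt_pow (m + 1) y).div_const ((m + 1).factorial : ℝ)).congr_deriv ?_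
  rw [Nat.factorial_succ]
  push_cast
  field_simp

theorem hasDerivAt_expPartial_succ (m : ℕ) (y : ℝ) :
    HasDerivAt (expPartial (m + 1)) (expPartial m y) y := by
  induction m with
  | zero =>
    have : expPartial (0 + 1) = fun y => 1 + y := by
      ext y; simp [expPartial, Finset.sum_range_succ]
    rw [this]
    simpa [expPartial] using (hasDerivAt_id y).const_add 1
  | succ m ih =>
    have : expPartial (m + 1 + 1) = fun y =>
        expPartial (m + 1) y + y ^ (m + 1 + 1) / ((m + 1 + 1).factorial : ℝ) := by
      ext y; exact expPartial_succ _ _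
    rw [this, expPartial_succ]
    exact ih.add (hasDerivAt_pow_div_factorial (m + 1) y)

theorem hasDerivAt_expTail_succ (m : ℕ) (y : ℝ) :
    HasDerivAt (expTail (m + 1)) (expTail m y) y := by
  induction m using Nat.twoStepInduction with
  | zero => exact (Real.hasDerivAt_cosh y).sub_const 1
  | one =>
    exact ((Real.hasDerivAt_sinh y).sub (hasDerivAt_pow_div_factorial 0 y)).congr_deriv
      (by simp [expTail])
  | more m ih _ => exact ih.sub (hasDerivAt_pow_div_factorial (m + 1) y)

theorem continuous_expPartial (m : ℕ) : Continuous (expPartial m) := by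
  unfold expPartial
  fun_prop

theorem hasDerivAt_two_mul_log {b : ℝ} (hb : 0 < b) :
    HasDerivAt (fun b => 2 * Real.log b) (2 * b⁻¹) b :=
  (Real.hasDerivAt_log hb.ne').const_mul 2

theorem continuousOn_two_mul_log : ContinuousOn (fun b => 2 * Real.log b) (Set.Ioi 0) :=
  fun _ hb => (hasDerivAt_two_mul_log hb).continuousAt.continuousWithinAt

/-! ### The three closed forms and their differential equations -/

/-- The probability that the ends of a path of `m` edges are vacant, if both ends lack a neighbour,
in terms of the vacancy probability `b` of a branch. -/
def coreForm (m : ℕ) (b : ℝ) : ℝ :=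
  (expPartial m (2 * Real.log b) + expPartial (m + 1) (2 * Real.log b)) / 2

/-- The probability that the ends of a path of `m` edges are vacant, if one end lacks a neighbour,
in terms of the vacancy probability `b` of a branch. -/
def halfForm (m : ℕ) (b : ℝ) : ℝ := b * (expPartial m (2 * Real.log b) + 1) / 2

/-- The probability that the ends of a path of `m` edges in a regular tree are vacant,
in terms of the vacancy probability `b` of a branch. -/
def fullForm (m : ℕ) (b : ℝ) : ℝ :=
  (1 + b ^ 2) ^ 2 / 4 - b ^ 2 / 2 * expTail m (2 * Real.log b)

theorem coreForm_one (m : ℕ) : coreForm m 1 = 1 := by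
  simp [coreForm, expPartial_zero_right]

theorem halfForm_one (m : ℕ) : halfForm m 1 = 1 := by
  norm_num [halfForm, expPartial_zero_right]

theorem fullForm_one (m : ℕ) : fullForm m 1 = 1 := by
  norm_num [fullForm, expTail_zero_right]

theorem continuousOn_coreForm (m : ℕ) : ContinuousOn (coreForm m) (Set.Ioi 0) :=
  (((continuous_expPartial m).comp_continuousOn continuousOn_two_mul_log).add
    ((continuous_expPartial (m + 1)).comp_continuousOn continuousOn_two_mul_log)).div_const 2

theorem continuousOn_halfForm (m : ℕ) : ContinuousOn (halfForm m) (Set.Ioi 0) :=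
  (continuousOn_id.mul (((continuous_expPartial m).comp_continuousOn
    continuousOn_two_mul_log).add continuousOn_const)).div_const 2

theorem hasDerivAt_coreForm_zero {b : ℝ} (hb : 0 < b) : HasDerivAt (coreForm 0) b⁻¹ b := by
  have : coreForm 0 = fun b => 1 + Real.log b := by
    ext b
    simp [coreForm, expPartial, Finset.sum_range_succ]
    ring
  rw [this]
  exact (Real.hasDerivAt_log hb.ne').const_add 1

theorem hasDerivAt_coreForm_succ (m : ℕ) {b : ℝ} (hb : 0 < b) :
    HasDerivAt (coreForm (m + 1)) (2 * coreForm m b * b⁻¹) b := by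
  have h := (((hasDerivAt_expPartial_succ m _).comp b (hasDerivAt_two_mul_log hb)).add
    ((hasDerivAt_expPartial_succ (m + 1) _).comp b (hasDerivAt_two_mul_log hb))).div_const 2
  refine h.congr_deriv ?_
  rw [coreForm]
  ring

theorem hasDerivAt_halfForm_zero (b : ℝ) : HasDerivAt (halfForm 0) 1 b := by
  have : halfForm 0 = fun b => b := by
    ext b
    simp [halfForm, expPartial]
    ring
  rw [this]
  exact hasDerivAt_id b

theorem hasDerivAt_halfForm_succ (m : ℕ) {b : ℝ} (hb : 0 < b) :
    HasDerivAt (halfForm (m + 1)) (halfForm m b * b⁻¹ + coreForm m b) b := by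
  have h := ((hasDerivAt_id b).mul (((hasDerivAt_expPartial_succ m _).comp b
    (hasDerivAt_two_mul_log hb)).add_const 1)).div_const 2
  refine h.congr_deriv ?_
  simp only [halfForm, coreForm, id, Function.comp]
  field_simp
  ring

theorem fullForm_zero {b : ℝ} (hb : 0 < b) : fullForm 0 b = (1 + b ^ 2) / 2 := by
  have h1 : Real.exp (2 * Real.log b) = b ^ 2 := by
    rw [mul_comm, Real.exp_mul, Real.exp_log hb]
    norm_num
  rw [fullForm, expTail, Real.sinh_eq, Real.exp_neg, h1]
  field_simp
  ring

theorem hasDerivAt_fullForm_zero {b : ℝ} (hb : 0 < b) : HasDerivAt (fullForm 0) b b := by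
  have h : HasDerivAt (fun b : ℝ => (1 + b ^ 2) / 2) b b := by
    exact (((hasDerivAt_pow 2 b).const_add 1).div_const 2).congr_deriv (by simp)
  refine h.congr_of_eventuallyEq ?_
  filter_upwards [lt_mem_nhds hb] with b hb
  exact fullForm_zero hb

/-- Differentiation produces two consecutive tails; their sum `b ^ 2 - expPartial m (2 * Real.log
b)` leaves exactly the polynomial in `halfForm`. -/
theorem hasDerivAt_fullForm_succ (m : ℕ) {b : ℝ} (hb : 0 < b) :
    HasDerivAt (fullForm (m + 1)) (2 * halfForm m b) b := by
  have h := ((((hasDerivAt_pow 2 b).const_add 1).pow 2).div_const 4).sub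
    (((hasDerivAt_pow 2 b).div_const 2).mul ((hasDerivAt_expTail_succ m _).comp b
    (hasDerivAt_two_mul_log hb)))
  refine h.congr_deriv ?_
  have h1 : Real.exp (2 * Real.log b) = b ^ 2 := by
    rw [mul_comm, Real.exp_mul, Real.exp_log hb]
    norm_num
  have h2 := expTail_add_expTail_succ m (2 * Real.log b)
  rw [h1] at h2
  have h3 : expPartial m (2 * Real.log b) =
      b ^ 2 - expTail m (2 * Real.log b) - expTail (m + 1) (2 * Real.log b) := by linarith
  simp only [halfForm, Function.comp, h3]
  field_simp
  ring

/-! ### The integral equation for the vacancy probability of a branch -/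

theorem intervalIntegrable_of_measurable_of_bound {f : ℝ → ℝ} (hf : Measurable f) {C : ℝ}
    (hC : ∀ s, ‖f s‖ ≤ C) (a b : ℝ) : IntervalIntegrable f volume a b := by
  rw [intervalIntegrable_iff]
  exact Measure.integrableOn_of_bounded (M := C) (by simp) hf.aestronglyMeasurable
    (Eventually.of_forall hC)

/-- `β` takes values in `[0, 1]` and solves `β' = -β ^ k`, `β 0 = 1` on `[0, 1]`. -/
structure IsBranchSolution (β : ℝ → ℝ) (k : ℕ) : Prop where
  measurable : Measurable β
  mem : ∀ t, β t ∈ Set.Icc (0 : ℝ) 1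
  eq : ∀ t ∈ Set.Icc (0 : ℝ) 1, β t = 1 - ∫ s in (0 : ℝ)..t, β s ^ k

namespace IsBranchSolution

variable {β : ℝ → ℝ} {k : ℕ}

theorem intervalIntegrable (h : IsBranchSolution β k) (a b : ℝ) :
    IntervalIntegrable (fun s => β s ^ k) volume a b := by
  refine intervalIntegrable_of_measurable_of_bound (h.measurable.pow_const k) (C := 1)
    (fun s => ?_) a b
  rw [Real.norm_of_nonneg (pow_nonneg (h.mem s).1 k)]
  exact pow_le_one₀ (h.mem s).1 (h.mem s).2

theorem continuousOn (h : IsBranchSolution β k) : ContinuousOn β (Set.Icc 0 1) := by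
  have hc : Continuous fun t => 1 - ∫ s in (0 : ℝ)..t, β s ^ k :=
    continuous_const.sub (intervalIntegral.continuous_primitive h.intervalIntegrable 0)
  exact hc.continuousOn.congr h.eq

theorem hasDerivAt (h : IsBranchSolution β k) {t : ℝ} (ht : t ∈ Set.Ioo (0 : ℝ) 1) :
    HasDerivAt β (-(β t ^ k)) t := by
  have hc : ContinuousAt β t := h.continuousOn.continuousAt (Icc_mem_nhds ht.1 ht.2)
  have hd := (intervalIntegral.integral_hasDerivAt_right (h.intervalIntegrable 0 t)
    ((h.measurable.pow_const k).stronglyMeasurable.stronglyMeasurableAtFilter)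
    (hc.pow k)).const_sub 1
  refine hd.congr_of_eventuallyEq ?_
  filter_upwards [Icc_mem_nhds ht.1 ht.2] with s hs using h.eq s hs

theorem zero (h : IsBranchSolution β k) : β 0 = 1 := by
  rw [h.eq 0 (by simp)]
  simp

/-- Since `0 ≤ β ≤ 1` and `k ≥ 1`, `β' = -β ^ k ≥ -β`, so `β s * exp s` is nondecreasing from `1`.
-/
theorem pos (h : IsBranchSolution β k) (hk : 1 ≤ k) {t : ℝ} (ht : t ∈ Set.Icc (0 : ℝ) 1) :
    0 < β t := by
  have hd : ∀ s ∈ Set.Ioo (0 : ℝ) 1,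
      HasDerivAt (fun s => β s * Real.exp s) ((β s - β s ^ k) * Real.exp s) s := fun s hs => by
    exact ((h.hasDerivAt hs).mul (Real.hasDerivAt_exp s)).congr_deriv (by ring)
  have hmono : MonotoneOn (fun s => β s * Real.exp s) (Set.Icc 0 1) := by
    refine monotoneOn_of_deriv_nonneg (convex_Icc 0 1)
      (h.continuousOn.mul Real.continuous_exp.continuousOn) ?_ ?_
    · rw [interior_Icc]
      exact fun s hs => (hd s hs).differentiableAt.differentiableWithinAt
    · rw [interior_Icc]
      intro s hs
      rw [(hd s hs).deriv]
      exact mul_nonneg (sub_nonneg.2 (pow_le_of_le_one (h.mem s).1 (h.mem s).2 (by omega)))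
        (Real.exp_pos s).le
  have h1 := hmono (show (0 : ℝ) ∈ Set.Icc (0 : ℝ) 1 by simp) ht ht.1
  simp only [h.zero, Real.exp_zero, mul_one] at h1
  exact pos_of_mul_pos_left (by linarith) (Real.exp_pos t).le

theorem continuousOn_comp (h : IsBranchSolution β k) (hk : 1 ≤ k) {f : ℝ → ℝ}
    (hf : ContinuousOn f (Set.Ioi 0)) {t : ℝ} (ht : t ∈ Set.Icc (0 : ℝ) 1) :
    ContinuousOn (fun s => f (β s)) (Set.Icc 0 t) :=
  hf.comp (h.continuousOn.mono (Set.Icc_subset_Icc_right ht.2)) fun _ hs =>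
    h.pos hk ⟨hs.1, hs.2.trans ht.2⟩

/-- The chain rule with `β' = -β ^ k` replaces the time variable by `b = β t`; integral equations
then become conditions on derivatives in `b`. -/
theorem eq_one_sub_integral (h : IsBranchSolution β k) (hk : 1 ≤ k) {F f : ℝ → ℝ}
    (hF : ∀ b, 0 < b → HasDerivAt F (f b) b) (hf : ContinuousOn f (Set.Ioi 0)) (h1 : F 1 = 1)
    {t : ℝ} (ht : t ∈ Set.Icc (0 : ℝ) 1) :
    F (β t) = 1 - ∫ s in (0 : ℝ)..t, f (β s) * β s ^ k := by
  have hFc : ContinuousOn F (Set.Ioi 0) := fun b hb => (hF b hb).continuousAt.continuousWithinAt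
  have hsub : Set.Icc 0 t ⊆ Set.Icc 0 1 := Set.Icc_subset_Icc_right ht.2
  have := intervalIntegral.integral_eq_sub_of_hasDerivAt_of_le (f := fun s => F (β s))
    (f' := fun s => f (β s) * -(β s ^ k)) ht.1 (h.continuousOn_comp hk hFc ht)
    (fun s hs => (hF _ (h.pos hk (hsub ⟨hs.1.le, hs.2.le⟩))).comp s
      (h.hasDerivAt ⟨hs.1, hs.2.trans_le ht.2⟩))
    (ContinuousOn.intervalIntegrable_of_Icc ht.1
      ((h.continuousOn_comp hk hf ht).mul ((h.continuousOn.mono hsub).pow k).neg))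
  simp only [mul_neg, intervalIntegral.integral_neg, h.zero, h1] at this
  linarith

end IsBranchSolution

end BlockingRSA

end

noncomputable section

namespace BlockingRSA

/-! ### Vacancy probabilities of branches and of pairs -/

/-- Factors in `[0, 1]` are exchanged one at a time. The estimate is assumed for all pairs of
factors, so no matching of the index sets is needed. -/
theorem abs_prod_sub_prod_le {ι ι' : Type*} {A : Finset ι} {A' : Finset ι'} {n : ℕ} {ε : ℝ}
    (hA : A.card = n) (hA' : A'.card = n) {f : ι → ℝ} {f' : ι' → ℝ}
    (hf : ∀ i, f i ∈ Set.Icc (0 : ℝ) 1) (hf' : ∀ i, f' i ∈ Set.Icc (0 : ℝ) 1)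
    (h : ∀ i ∈ A, ∀ i' ∈ A', |f i - f' i'| ≤ ε) :
    |∏ i ∈ A, f i - ∏ i ∈ A', f' i| ≤ n * ε := by
  classical
  induction n generalizing A A' with
  | zero => simp [Finset.card_eq_zero.1 hA, Finset.card_eq_zero.1 hA']
  | succ n ih =>
    obtain ⟨a, B, ha, rfl, hB⟩ := Finset.card_eq_succ.1 hA
    obtain ⟨a', B', ha', rfl, hB'⟩ := Finset.card_eq_succ.1 hA'
    have h1 := ih hB hB' fun i hi i' hi' =>
      h i (Finset.mem_insert_of_mem hi) i' (Finset.mem_insert_of_mem hi')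
    have h2 := h a (Finset.mem_insert_self _ _) a' (Finset.mem_insert_self _ _)
    rw [Finset.prod_insert ha, Finset.prod_insert ha']
    set p := ∏ i ∈ B, f i
    set p' := ∏ i ∈ B', f' i
    have hp0 : 0 ≤ p' := Finset.prod_nonneg fun i _ => (hf' i).1
    have hp1 : p' ≤ 1 := Finset.prod_le_one (fun i _ => (hf' i).1) fun i _ => (hf' i).2
    calc |f a * p - f' a' * p'| = |f a * (p - p') + (f a - f' a') * p'| := by ring_nf
      _ ≤ |f a| * |p - p'| + |f a - f' a'| * |p'| := by
        rw [← abs_mul, ← abs_mul]; exact abs_add_le _ _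
      _ ≤ 1 * (n * ε) + ε * 1 := by
        refine add_le_add ?_ ?_
        · exact mul_le_mul (abs_le.2 ⟨by linarith [(hf a).1], (hf a).2⟩) h1 (abs_nonneg _) zero_le_one
        · exact mul_le_mul h2 (abs_le.2 ⟨by linarith, hp1⟩) (abs_nonneg _) ((abs_nonneg _).trans h2)
      _ = (n + 1 : ℕ) * ε := by push_cast; ring

variable {V : Type*} {G : SimpleGraph V} {U : Set V} {v w c : V}
  {Ω : Type*} [MeasurableSpace Ω] {P : Measure Ω} {τ : V → Ω → ℝ}

/-- Arrival times on the sites of a locally finite forest, such that almost surely there are no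
infinite chains of earlier neighbours. -/
structure ForestProcess (G : SimpleGraph V) (τ : V → Ω → ℝ) (P : Measure Ω) : Prop where
  finite_neighborSet : ∀ v, (G.neighborSet v).Finite
  isAcyclic : G.IsAcyclic
  isArrivalTimes : IsArrivalTimes τ P
  wellFounded : ∀ᵐ ω ∂P, WellFounded (Precedes G fun u => τ u ω)

theorem measurable_prod_vacProb [Countable V] [IsProbabilityMeasure P] (hτ : IsArrivalTimes τ P)
    (A : Finset V) (B : V → Set V) :
    Measurable fun s => ∏ c ∈ A, vacProb G τ P (B c) c s :=
  Finset.measurable_prod _ fun c _ => hτ.measurable_vacProb (B c) c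

theorem norm_prod_vacProb_le [IsProbabilityMeasure P] (A : Finset V) (B : V → Set V) (s : ℝ) :
    ‖∏ c ∈ A, vacProb G τ P (B c) c s‖ ≤ 1 := by
  rw [Real.norm_of_nonneg (Finset.prod_nonneg fun c _ => (vacProb_mem _ _ _).1)]
  exact Finset.prod_le_one (fun c _ => (vacProb_mem _ _ _).1) fun c _ => (vacProb_mem _ _ _).2

theorem NearlyRegular.card_nbr_of_branch {hG : ∀ v, (G.neighborSet v).Finite} {k : ℕ}
    (h : NearlyRegular hG k U v v 1 0) (hv : v ∈ U) : (nbr hG U v).card = k := by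
  have := h v hv
  simp at this
  omega

theorem NearlyRegular.branch {hG : ∀ v, (G.neighborSet v).Finite} {k : ℕ}
    (h : NearlyRegular hG k U v v 1 0) (hA : G.IsAcyclic) (hv : v ∈ U) (hc : c ∈ nbr hG U v) :
    NearlyRegular hG k (U ∩ branch G v c) c c 1 0 := by
  rw [mem_nbr] at hc
  exact h.inter_branch_of_notMem hA hc.1 hv fun h' => ne_of_mem_branch hc.1.ne' h' rfl

theorem mem_inter_branch {hG : ∀ v, (G.neighborSet v).Finite} (hc : c ∈ nbr hG U v) :
    c ∈ U ∩ branch G v c :=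
  ⟨(mem_nbr.1 hc).2, mem_branch_self⟩

/-! ### All branches have the same vacancy probability -/

section Homogeneity

variable [Countable V] [IsProbabilityMeasure P]
  {V' : Type*} [Countable V'] {G' : SimpleGraph V'} {Ω' : Type*} [MeasurableSpace Ω']
  {P' : Measure Ω'} [IsProbabilityMeasure P'] {τ' : V' → Ω' → ℝ}

/-- Picard iteration: both sides satisfy integral equations with `k` factors that are again
branches, and each round gains a factor `k` and an integration. Two forests on separate probability
spaces are compared without any isomorphism between them. -/
theorem abs_vacProb_sub_le (h : ForestProcess G τ P) (h' : ForestProcess G' τ' P') {k : ℕ} (n : ℕ)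
    {U : Set V} {v : V} {U' : Set V'} {v' : V'} (hv : v ∈ U) (hv' : v' ∈ U')
    (hU : NearlyRegular h.finite_neighborSet k U v v 1 0)
    (hU' : NearlyRegular h'.finite_neighborSet k U' v' v' 1 0) {t : ℝ}
    (ht : t ∈ Set.Icc (0 : ℝ) 1) :
    |vacProb G τ P U v t - vacProb G' τ' P' U' v' t| ≤ (k * t) ^ n / n.factorial := by
  induction n generalizing U v U' v' t with
  | zero =>
    have h1 := vacProb_mem (G := G) (τ := τ) (P := P) U v t
    have h2 := vacProb_mem (G := G') (τ := τ') (P := P') U' v' t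
    simp only [pow_zero, Nat.factorial_zero, Nat.cast_one, div_one, abs_le]
    constructor <;> linarith [h1.1, h1.2, h2.1, h2.2]
  | succ n ih =>
    rw [h.isArrivalTimes.vacProb_eq h.finite_neighborSet h.isAcyclic h.wellFounded hv ht,
      h'.isArrivalTimes.vacProb_eq h'.finite_neighborSet h'.isAcyclic h'.wellFounded hv' ht,
      sub_sub_sub_cancel_left, ← intervalIntegral.integral_sub
        (intervalIntegrable_of_measurable_of_bound (measurable_prod_vacProb h'.isArrivalTimes _ _)
          (norm_prod_vacProb_le _ _) _ _)
        (intervalIntegrable_of_measurable_of_bound (measurable_prod_vacProb h.isArrivalTimes _ _)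
          (norm_prod_vacProb_le _ _) _ _), ← Real.norm_eq_abs]
    refine (intervalIntegral.norm_integral_le_of_norm_le ht.1
      (g := fun s : ℝ => k * ((k * s) ^ n / n.factorial)) (Eventually.of_forall fun s hs => ?_)
      ((by fun_prop : Continuous fun s : ℝ =>
        (k : ℝ) * ((k * s) ^ n / n.factorial)).intervalIntegrable _ _)).trans_eq ?_
    · rw [Real.norm_eq_abs, abs_sub_comm]
      refine abs_prod_sub_prod_le (hU.card_nbr_of_branch hv) (hU'.card_nbr_of_branch hv')
        (fun c => vacProb_mem _ _ _) (fun c => vacProb_mem _ _ _) fun c hc c' hc' => ?_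
      exact ih (mem_inter_branch hc) (mem_inter_branch hc') (hU.branch h.isAcyclic hv hc)
        (hU'.branch h'.isAcyclic hv' hc') ⟨hs.1.le, hs.2.trans ht.2⟩
    · have : ∀ s : ℝ, (k : ℝ) * ((k * s) ^ n / n.factorial) =
          ((k : ℝ) ^ (n + 1) / n.factorial) * s ^ n := fun s => by ring
      simp only [this]
      rw [intervalIntegral.integral_const_mul, integral_pow, Nat.factorial_succ]
      push_cast
      field_simp
      simp [mul_pow]

theorem vacProb_eq_vacProb (h : ForestProcess G τ P) (h' : ForestProcess G' τ' P') {k : ℕ}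
    {U : Set V} {v : V} {U' : Set V'} {v' : V'} (hv : v ∈ U) (hv' : v' ∈ U')
    (hU : NearlyRegular h.finite_neighborSet k U v v 1 0)
    (hU' : NearlyRegular h'.finite_neighborSet k U' v' v' 1 0) {t : ℝ}
    (ht : t ∈ Set.Icc (0 : ℝ) 1) : vacProb G τ P U v t = vacProb G' τ' P' U' v' t := by
  have h0 := ge_of_tendsto' (FloorSemiring.tendsto_pow_div_factorial_atTop (k * t))
    fun n => abs_vacProb_sub_le h h' n hv hv' hU hU' ht
  exact sub_eq_zero.1 (abs_eq_zero.1 (le_antisymm h0 (abs_nonneg _)))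

theorem ForestProcess.isBranchSolution (h : ForestProcess G τ P) {k : ℕ} (hv : v ∈ U)
    (hU : NearlyRegular h.finite_neighborSet k U v v 1 0) :
    IsBranchSolution (vacProb G τ P U v) k where
  measurable := h.isArrivalTimes.measurable_vacProb U v
  mem := vacProb_mem U v
  eq t ht := by
    rw [h.isArrivalTimes.vacProb_eq h.finite_neighborSet h.isAcyclic h.wellFounded hv ht]
    congr 1
    refine intervalIntegral.integral_congr fun s hs => ?_
    rw [Set.uIcc_of_le ht.1] at hs
    rw [Finset.prod_congr rfl fun c hc => vacProb_eq_vacProb h h (mem_inter_branch hc) hv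
      (hU.branch h.isAcyclic hv hc) hU ⟨hs.1, hs.2.trans ht.2⟩, Finset.prod_const,
      hU.card_nbr_of_branch hv]

end Homogeneity

/-! ### Recursion on the distance between the two sites -/

section Pairs

variable {k p q m : ℕ} {β : ℝ → ℝ} {t : ℝ}

theorem vacProb₂_self (U : Set V) (v : V) (t : ℝ) :
    vacProb₂ G τ P U v v t = vacProb G τ P U v t := by
  simp only [vacProb₂, vacProb, vac_mul_self]

/-- `β t` is the common vacancy probability at time `t` of the roots of all branches. -/
def IsBranchVacancy (h : ForestProcess G τ P) (k : ℕ) (β : ℝ → ℝ) : Prop :=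
  ∀ U v, v ∈ U → NearlyRegular h.finite_neighborSet k U v v 1 0 →
    ∀ t ∈ Set.Icc (0 : ℝ) 1, vacProb G τ P U v t = β t

theorem vacProb_eq_of_nearlyRegular [Countable V] [IsProbabilityMeasure P]
    (h : ForestProcess G τ P) (hβ : IsBranchVacancy h k β)
    (hv : v ∈ U) (hU : NearlyRegular h.finite_neighborSet k U v v p q)
    (ht : t ∈ Set.Icc (0 : ℝ) 1) :
    vacProb G τ P U v t = 1 - ∫ s in (0 : ℝ)..t, β s ^ (k + 1 - p - q) := by
  rw [h.isArrivalTimes.vacProb_eq h.finite_neighborSet h.isAcyclic h.wellFounded hv ht]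
  congr 1
  refine intervalIntegral.integral_congr fun s hs => ?_
  rw [Set.uIcc_of_le ht.1] at hs
  have hcard := hU v hv
  simp only [if_true] at hcard
  rw [Finset.prod_congr rfl fun c hc => hβ _ c (mem_inter_branch hc)
    (hU.inter_branch_of_notMem h.isAcyclic (mem_nbr.1 hc).1 hv
      fun h' => ne_of_mem_branch (mem_nbr.1 hc).1.ne' h' rfl) s ⟨hs.1, hs.2.trans ht.2⟩,
    Finset.prod_const, show (nbr h.finite_neighborSet U v).card = k + 1 - p - q by omega]

/-- Of the `k + 1 - p` branches at `v`, all but the one towards `w` are ordinary branches and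
contribute `β` each. -/
theorem prod_vacProb_erase [DecidableEq V] (h : ForestProcess G τ P) (hβ : IsBranchVacancy h k β)
    (hv : v ∈ U) (hvw : v ≠ w) (hU : NearlyRegular h.finite_neighborSet k U v w p q)
    (hc : G.Adj v c) (hcU : c ∈ U) (hwc : w ∈ branch G v c) (ht : t ∈ Set.Icc (0 : ℝ) 1) :
    ∏ d ∈ (nbr h.finite_neighborSet U v).erase c, vacProb G τ P (U ∩ branch G v d) d t =
      β t ^ (k - p) := by
  have hcard := hU v hv
  rw [if_pos rfl, if_neg hvw] at hcard
  rw [Finset.prod_congr rfl fun d hd => ?_, Finset.prod_const,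
    Finset.card_erase_of_mem (mem_nbr.2 ⟨hc, hcU⟩),
    show (nbr h.finite_neighborSet U v).card - 1 = k - p by omega]
  have hd' := Finset.mem_of_mem_erase hd
  refine hβ _ d (mem_inter_branch hd') (hU.inter_branch_of_notMem h.isAcyclic (mem_nbr.1 hd').1 hv
    fun hw => ?_) t ht
  exact Finset.ne_of_mem_erase hd (eq_of_mem_branch h.isAcyclic (mem_nbr.1 hd').1 hc hw hwc)

/-- Advancing one end gives it defect `1`, whatever it had before, and keeps the defect of the other
end: hence `q` for `f`, where `v` moves, and `p` for `g`, where `w` moves. -/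
theorem vacProb₂_eq_of_linked_succ [Countable V] [IsProbabilityMeasure P]
    (h : ForestProcess G τ P) (hβ : IsBranchVacancy h k β)
    {f g : ℝ → ℝ}
    (hf : ∀ U v w, Linked G U v w m → NearlyRegular h.finite_neighborSet k U v w 1 q →
      ∀ s ∈ Set.Icc (0 : ℝ) 1, vacProb₂ G τ P U v w s = f (β s))
    (hg : ∀ U v w, Linked G U v w m → NearlyRegular h.finite_neighborSet k U v w 1 p →
      ∀ s ∈ Set.Icc (0 : ℝ) 1, vacProb₂ G τ P U v w s = g (β s))
    (hl : Linked G U v w (m + 1)) (hU : NearlyRegular h.finite_neighborSet k U v w p q)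
    (ht : t ∈ Set.Icc (0 : ℝ) 1) :
    vacProb₂ G τ P U v w t = 1 - (∫ s in (0 : ℝ)..t, f (β s) * β s ^ (k - p)) -
      ∫ s in (0 : ℝ)..t, g (β s) * β s ^ (k - q) := by
  classical
  obtain ⟨c, hc, hcU, hwc, hvw, hlc⟩ := hl.exists_step
  obtain ⟨d, hd, hdU, hvd, -, hld⟩ := hl.symm.exists_step
  have hv := hl.left_mem
  have hw := hl.symm.left_mem
  rw [h.isArrivalTimes.vacProb₂_eq h.finite_neighborSet h.isAcyclic h.wellFounded hv hw hvw hc hcU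
    hwc hd hdU hvd ht]
  congr 1
  · congr 1
    refine intervalIntegral.integral_congr fun s hs => ?_
    rw [Set.uIcc_of_le ht.1] at hs
    have hs' : s ∈ Set.Icc (0 : ℝ) 1 := ⟨hs.1, hs.2.trans ht.2⟩
    rw [hf _ _ _ hlc (hU.inter_branch h.isAcyclic hc hv) s hs',
      prod_vacProb_erase h hβ hv hvw hU hc hcU hwc hs']
  · refine intervalIntegral.integral_congr fun s hs => ?_
    rw [Set.uIcc_of_le ht.1] at hs
    have hs' : s ∈ Set.Icc (0 : ℝ) 1 := ⟨hs.1, hs.2.trans ht.2⟩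
    rw [hg _ _ _ hld (hU.symm.inter_branch h.isAcyclic hd hw) s hs',
      prod_vacProb_erase h hβ hw hvw.symm hU.symm hd hdU hvd hs']

theorem vacProb₂_eq_of_hasDerivAt [Countable V] [IsProbabilityMeasure P]
    (h : ForestProcess G τ P) (hk : 1 ≤ k)
    (hβ : IsBranchVacancy h k β) (hβ' : IsBranchSolution β k) {f g F F' : ℝ → ℝ}
    (hf : ∀ U v w, Linked G U v w m → NearlyRegular h.finite_neighborSet k U v w 1 q →
      ∀ s ∈ Set.Icc (0 : ℝ) 1, vacProb₂ G τ P U v w s = f (β s))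
    (hg : ∀ U v w, Linked G U v w m → NearlyRegular h.finite_neighborSet k U v w 1 p →
      ∀ s ∈ Set.Icc (0 : ℝ) 1, vacProb₂ G τ P U v w s = g (β s))
    (hl : Linked G U v w (m + 1)) (hU : NearlyRegular h.finite_neighborSet k U v w p q)
    (ht : t ∈ Set.Icc (0 : ℝ) 1)
    (hfc : ContinuousOn f (Set.Ioi 0)) (hgc : ContinuousOn g (Set.Ioi 0))
    (hF : ∀ b, 0 < b → HasDerivAt F (F' b) b) (hF' : ContinuousOn F' (Set.Ioi 0)) (h1 : F 1 = 1)
    (hfg : ∀ b, 0 < b → F' b * b ^ k = f b * b ^ (k - p) + g b * b ^ (k - q)) :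
    vacProb₂ G τ P U v w t = F (β t) := by
  rw [vacProb₂_eq_of_linked_succ h hβ hf hg hl hU ht, hβ'.eq_one_sub_integral hk hF hF' h1 ht,
    sub_sub, ← intervalIntegral.integral_add]
  · congr 1
    refine intervalIntegral.integral_congr fun s hs => ?_
    rw [Set.uIcc_of_le ht.1] at hs
    exact (hfg _ (hβ'.pos hk ⟨hs.1, hs.2.trans ht.2⟩)).symm
  · exact ContinuousOn.intervalIntegrable_of_Icc ht.1
      (hβ'.continuousOn_comp hk (hfc.mul (continuousOn_id.pow (k - p))) ht)
  · exact ContinuousOn.intervalIntegrable_of_Icc ht.1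
      (hβ'.continuousOn_comp hk (hgc.mul (continuousOn_id.pow (k - q))) ht)

/-- At distance zero the ends coincide: the defects add up at one site, and the pair probability is
a one-site probability. -/
theorem vacProb₂_eq_of_linked_zero [Countable V] [IsProbabilityMeasure P]
    (h : ForestProcess G τ P) (hk : 1 ≤ k)
    (hβ : IsBranchVacancy h k β) (hβ' : IsBranchSolution β k) {F F' : ℝ → ℝ}
    (hl : Linked G U v w 0) (hU : NearlyRegular h.finite_neighborSet k U v w p q)
    (ht : t ∈ Set.Icc (0 : ℝ) 1)
    (hF : ∀ b, 0 < b → HasDerivAt F (F' b) b) (hF' : ContinuousOn F' (Set.Ioi 0)) (h1 : F 1 = 1)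
    (hfg : ∀ b, 0 < b → F' b * b ^ k = b ^ (k + 1 - p - q)) :
    vacProb₂ G τ P U v w t = F (β t) := by
  obtain rfl := hl.eq_of_zero
  rw [vacProb₂_self, vacProb_eq_of_nearlyRegular h hβ hl.left_mem hU ht,
    hβ'.eq_one_sub_integral hk hF hF' h1 ht]
  congr 1
  refine intervalIntegral.integral_congr fun s hs => ?_
  rw [Set.uIcc_of_le ht.1] at hs
  exact (hfg _ (hβ'.pos hk ⟨hs.1, hs.2.trans ht.2⟩)).symm

theorem continuousOn_inv_Ioi : ContinuousOn (fun b : ℝ => b⁻¹) (Set.Ioi 0) :=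
  continuousOn_id.inv₀ fun _ hb => ne_of_gt hb

theorem vacProb₂_core [Countable V] [IsProbabilityMeasure P]
    (h : ForestProcess G τ P) (hk : 1 ≤ k)
    (hβ : IsBranchVacancy h k β) (hβ' : IsBranchSolution β k) :
    ∀ U v w, Linked G U v w m → NearlyRegular h.finite_neighborSet k U v w 1 1 →
      ∀ t ∈ Set.Icc (0 : ℝ) 1, vacProb₂ G τ P U v w t = coreForm m (β t) := by
  induction m with
  | zero =>
    intro U v w hl hU t ht
    refine vacProb₂_eq_of_linked_zero h hk hβ hβ' hl hU ht
      (fun b hb => hasDerivAt_coreForm_zero hb) continuousOn_inv_Ioi (coreForm_one 0)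
      fun b hb => ?_
    -- Since `k ≥ 1`, the truncated exponent `k + 1 - 1 - 1` is the true `k - 1`.
    obtain ⟨j, rfl⟩ : ∃ j, k = j + 1 := ⟨k - 1, by omega⟩
    rw [show j + 1 + 1 - 1 - 1 = j by omega, pow_succ]
    field_simp
  | succ m ih =>
    intro U v w hl hU t ht
    refine vacProb₂_eq_of_hasDerivAt h hk hβ hβ' ih ih hl hU ht (continuousOn_coreForm m)
      (continuousOn_coreForm m) (fun b hb => hasDerivAt_coreForm_succ m hb)
      ((continuousOn_const.mul (continuousOn_coreForm m)).mul continuousOn_inv_Ioi)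
      (coreForm_one _) fun b hb => ?_
    obtain ⟨j, rfl⟩ : ∃ j, k = j + 1 := ⟨k - 1, by omega⟩
    rw [show j + 1 - 1 = j by omega]
    field_simp
    ring

theorem vacProb₂_half [Countable V] [IsProbabilityMeasure P]
    (h : ForestProcess G τ P) (hk : 1 ≤ k)
    (hβ : IsBranchVacancy h k β) (hβ' : IsBranchSolution β k) :
    ∀ U v w, Linked G U v w m → NearlyRegular h.finite_neighborSet k U v w 1 0 →
      ∀ t ∈ Set.Icc (0 : ℝ) 1, vacProb₂ G τ P U v w t = halfForm m (β t) := by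
  induction m with
  | zero =>
    intro U v w hl hU t ht
    refine vacProb₂_eq_of_linked_zero h hk hβ hβ' hl hU ht
      (fun b _ => hasDerivAt_halfForm_zero b) continuousOn_const (halfForm_one 0)
      fun b hb => ?_
    obtain ⟨j, rfl⟩ : ∃ j, k = j + 1 := ⟨k - 1, by omega⟩
    rw [show j + 1 + 1 - 1 - 0 = j + 1 by omega, one_mul]
  | succ m ih =>
    intro U v w hl hU t ht
    refine vacProb₂_eq_of_hasDerivAt h hk hβ hβ' ih (vacProb₂_core h hk hβ hβ') hl hU ht
      (continuousOn_halfForm m) (continuousOn_coreForm m)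
      (fun b hb => hasDerivAt_halfForm_succ m hb)
      (((continuousOn_halfForm m).mul continuousOn_inv_Ioi).add (continuousOn_coreForm m))
      (halfForm_one _) fun b hb => ?_
    obtain ⟨j, rfl⟩ : ∃ j, k = j + 1 := ⟨k - 1, by omega⟩
    rw [show j + 1 - 1 = j by omega, show j + 1 - 0 = j + 1 by omega]
    field_simp
    ring

theorem vacProb₂_full [Countable V] [IsProbabilityMeasure P]
    (h : ForestProcess G τ P) (hk : 1 ≤ k)
    (hβ : IsBranchVacancy h k β) (hβ' : IsBranchSolution β k)
    (hl : Linked G U v w m) (hU : NearlyRegular h.finite_neighborSet k U v w 0 0)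
    (ht : t ∈ Set.Icc (0 : ℝ) 1) : vacProb₂ G τ P U v w t = fullForm m (β t) := by
  cases m with
  | zero =>
    refine vacProb₂_eq_of_linked_zero h hk hβ hβ' hl hU ht
      (fun b hb => hasDerivAt_fullForm_zero hb) continuousOn_id (fullForm_one 0)
      fun b hb => ?_
    simp only [Nat.sub_zero]
    ring
  | succ m =>
    have hh := vacProb₂_half (m := m) h hk hβ hβ'
    refine vacProb₂_eq_of_hasDerivAt h hk hβ hβ' hh hh hl hU ht
      (continuousOn_halfForm m) (continuousOn_halfForm m)
      (fun b hb => hasDerivAt_fullForm_succ m hb)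
      (continuousOn_const.mul (continuousOn_halfForm m)) (fullForm_one _) fun b hb => ?_
    simp only [Nat.sub_zero]
    ring

end Pairs

/-! ### The states of the infinite process -/

open Classical in
-- The finite states are eventually constant. Well-foundedness involves neither `t` nor `v`, so one
-- null set serves all times and sites.
theorem tendsto_finiteState {x : V → ℝ} (hG : ∀ v, (G.neighborSet v).Finite)
    (hx : WellFounded (Precedes G x)) (t : ℝ) (v : V) :
    Tendsto (fun S => finiteState G x S t v) atTop
      (𝓝 (if x v ≤ t ∧ AcceptedIn G x Set.univ v then 1 else 0)) := by
  refine tendsto_const_nhds.congr' ?_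
  filter_upwards [eventually_accepted_iff hG hx v] with S hS
  rw [finiteState, hS]

/-- `vac` looks just before `t` and `state` at `t`; they differ only if `v` arrives exactly at `t`,
an event of probability zero. -/
theorem state_eq_one_sub_vac {x : V → ℝ} (hG : ∀ v, (G.neighborSet v).Finite)
    (hx : WellFounded (Precedes G x)) {t : ℝ} {v : V} (hv : x v ≠ t) :
    state G x t v = 1 - vac G Set.univ v t x := by
  classical
  have hle : x v ≤ t ↔ x v < t := (lt_iff_le_and_ne.trans (and_iff_left hv)).symm
  rw [state, (tendsto_finiteState hG hx t v).limUnder_eq, vac]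
  simp only [hle]
  split_ifs <;> simp

theorem ForestProcess.wellDefined (h : ForestProcess G τ P) : WellDefined G τ P := by
  filter_upwards [h.wellFounded] with ω hω v t _
  have := tendsto_finiteState h.finite_neighborSet hω t v
  rwa [state, this.limUnder_eq]

theorem ForestProcess.ae_state_eq (h : ForestProcess G τ P) (t : ℝ) (v : V) :
    (fun ω => state G (fun u => τ u ω) t v) =ᵐ[P]
      fun ω => 1 - vac G Set.univ v t (fun u => τ u ω) := by
  filter_upwards [h.wellFounded, h.isArrivalTimes.ae_ne v t] with ω hω hne
  exact state_eq_one_sub_vac h.finite_neighborSet hω hne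

theorem ForestProcess.vacancyProb_eq [Countable V] (h : ForestProcess G τ P) (v : V) (t : ℝ) :
    vacancyProb G τ P v t = vacProb G τ P Set.univ v t := by
  classical
  have hm := (measurable_vac_right (G := G) (U := Set.univ) (v := v) t).comp
    h.isArrivalTimes.measurable_config
  have hms : MeasurableSet {ω | vac G Set.univ v t (fun u => τ u ω) = 1} :=
    hm (measurableSet_singleton 1)
  rw [vacancyProb, vacProb, measureReal_congr (t := {ω | vac G Set.univ v t (fun u => τ u ω) = 1}),
    ← integral_indicator_one hms]
  · refine integral_congr_ae (Eventually.of_forall fun ω => ?_)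
    simp only [Set.indicator_apply, Set.mem_ofPred_eq, vac]
    split_ifs <;> simp_all
  · filter_upwards [h.ae_state_eq t v] with ω hω
    rw [eq_iff_iff]
    change state G (fun u => τ u ω) t v = 0 ↔ vac G Set.univ v t (fun u => τ u ω) = 1
    rw [hω, sub_eq_zero, eq_comm]

theorem ForestProcess.siteCov_eq [Countable V] [IsProbabilityMeasure P] (h : ForestProcess G τ P)
    (v w : V) (t : ℝ) :
    siteCov G τ P t v w = vacProb₂ G τ P Set.univ v w t -
      vacProb G τ P Set.univ v t * vacProb G τ P Set.univ w t := by
  have hm : ∀ v, Measurable fun ω => vac G Set.univ v t (fun u => τ u ω) := fun v =>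
    (measurable_vac_right t).comp h.isArrivalTimes.measurable_config
  have hb : ∀ v, ∀ᵐ ω ∂P, ‖vac G Set.univ v t (fun u => τ u ω)‖ ≤ 1 := fun v =>
    Eventually.of_forall fun ω => by
      rw [Real.norm_of_nonneg (vac_nonneg t)]; exact vac_le_one t
  have hL : ∀ v, MemLp (fun ω => vac G Set.univ v t (fun u => τ u ω)) 2 P := fun v =>
    MemLp.of_bound (hm v).aestronglyMeasurable 1 (hb v)
  have hI : ∀ v, Integrable (fun ω => vac G Set.univ v t (fun u => τ u ω)) P := fun v =>
    Integrable.of_bound (hm v).aestronglyMeasurable 1 (hb v)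
  have hc : siteCov G τ P t v w = covariance (fun ω => 1 - vac G Set.univ v t (fun u => τ u ω))
      (fun ω => 1 - vac G Set.univ w t (fun u => τ u ω)) P := by
    unfold siteCov covariance
    rw [integral_congr_ae (h.ae_state_eq t v), integral_congr_ae (h.ae_state_eq t w)]
    refine integral_congr_ae ?_
    filter_upwards [h.ae_state_eq t v, h.ae_state_eq t w] with ω h1 h2
    rw [h1, h2]
  rw [hc, covariance_const_sub_left (hI v), covariance_const_sub_right (hI w), neg_neg,
    covariance_eq_sub (hL v) (hL w)]
  rfl

/-! ### The regular tree and the rooted tree as forest processes -/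

theorem card_nbr_univ {hG : ∀ v, (G.neighborSet v).Finite} {n : ℕ}
    (h : (G.neighborSet v).encard = n) : (nbr hG Set.univ v).card = n := by
  have : ((nbr hG Set.univ v : Finset V) : Set V) = G.neighborSet v := by
    ext u
    simp [mem_nbr]
  rw [← this, Set.encard_coe_eq_coe_finsetCard] at h
  exact_mod_cast h

theorem IsRegularTree.forestProcess [Countable V] [IsProbabilityMeasure P] {k : ℕ}
    (hG : IsRegularTree G k) (hτ : IsArrivalTimes τ P) : ForestProcess G τ P := by
  have hfin : ∀ v, (G.neighborSet v).Finite := fun v =>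
    Set.finite_of_encard_eq_coe (k := k + 1) (by simpa using hG.degree_eq v)
  refine ⟨hfin, hG.isTree.isAcyclic, hτ, hτ.ae_wellFounded hfin (D := k + 1) fun v => ?_⟩
  exact (card_nbr_univ (by simpa using hG.degree_eq v)).le

theorem IsRegularTree.nearlyRegular {k : ℕ} (hG : IsRegularTree G k)
    (hfin : ∀ v, (G.neighborSet v).Finite) (v w : V) :
    NearlyRegular hfin k Set.univ v w 0 0 := by
  intro z _
  simp only [ite_self, add_zero]
  exact card_nbr_univ (by simpa using hG.degree_eq z)

theorem IsRootedRegularTree.forestProcess [Countable V] [IsProbabilityMeasure P] {k : ℕ} {v₀ : V}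
    (hG : IsRootedRegularTree G k v₀) (hτ : IsArrivalTimes τ P) : ForestProcess G τ P := by
  have hfin : ∀ v, (G.neighborSet v).Finite := fun v => by
    by_cases hv : v = v₀
    · exact hv ▸ Set.finite_of_encard_eq_coe hG.degree_root
    · exact Set.finite_of_encard_eq_coe (k := k + 1) (by simpa using hG.degree_eq v hv)
  refine ⟨hfin, hG.isTree.isAcyclic, hτ, hτ.ae_wellFounded hfin (D := k + 1) fun v => ?_⟩
  by_cases hv : v = v₀
  · rw [hv, card_nbr_univ hG.degree_root]
    omega
  · exact (card_nbr_univ (by simpa using hG.degree_eq v hv)).le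

theorem IsRootedRegularTree.nearlyRegular {k : ℕ} {v₀ : V} (hG : IsRootedRegularTree G k v₀)
    (hfin : ∀ v, (G.neighborSet v).Finite) :
    NearlyRegular hfin k Set.univ v₀ v₀ 1 0 := by
  intro z _
  by_cases hz : z = v₀
  · simp [hz, card_nbr_univ hG.degree_root]
  · simp [hz, card_nbr_univ (n := k + 1) (by simpa using hG.degree_eq z hz)]

theorem _root_.SimpleGraph.IsTree.linked_univ (hG : G.IsTree) (v w : V) :
    Linked G Set.univ v w (G.dist v w) := by
  obtain ⟨p, hp, hl⟩ := (hG.connected v w).exists_path_of_dist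
  exact ⟨p, hp, hl, fun _ _ => Set.mem_univ _⟩

end BlockingRSA

end

theorem theorem13 (k : ℕ) (hk : 1 ≤ k)
    -- the regular tree `T_k` with its arrival times
    {V : Type*} [Countable V] (T : SimpleGraph V) (hT : BlockingRSA.IsRegularTree T k)
    {Ω : Type*} [MeasurableSpace Ω] (P : MeasureTheory.Measure Ω)
    [MeasureTheory.IsProbabilityMeasure P]
    (τ : V → Ω → ℝ) (hτ : BlockingRSA.IsArrivalTimes τ P)
    -- the rooted tree `T_k^*` with its arrival times
    {V' : Type*} [Countable V'] (T' : SimpleGraph V') (v₀ : V')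
    (hT' : BlockingRSA.IsRootedRegularTree T' k v₀)
    {Ω' : Type*} [MeasurableSpace Ω'] (P' : MeasureTheory.Measure Ω')
    [MeasureTheory.IsProbabilityMeasure P']
    (τ' : V' → Ω' → ℝ) (hτ' : BlockingRSA.IsArrivalTimes τ' P')
    -- `β(t)` is the vacancy probability of the root of `T_k^*`
    (β : ℝ → ℝ) (hβ : ∀ t, β t = BlockingRSA.vacancyProb T' τ' P' v₀ t) :
    BlockingRSA.WellDefined T τ P ∧ BlockingRSA.WellDefined T' τ' P' ∧
    ∀ t ∈ Set.Icc (0 : ℝ) 1, 0 < β t ∧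
      ∀ m : ℕ, 1 ≤ m →
        Summable (fun n : ℕ =>
          (2 * Real.log (β t)) ^ (m + 1 + 2 * n) / ((m + 1 + 2 * n).factorial : ℝ)) ∧
        ∀ v w : V, T.dist v w = m →
          BlockingRSA.siteCov T τ P t v w =
            -(β t ^ 2 / 2) * ∑' n : ℕ,
              (2 * Real.log (β t)) ^ (m + 1 + 2 * n) / ((m + 1 + 2 * n).factorial : ℝ) := by
  have h := hT.forestProcess hτ
  have h' := hT'.forestProcess hτ'
  have hroot := hT'.nearlyRegular h'.finite_neighborSet
  obtain rfl : β = BlockingRSA.vacProb T' τ' P' Set.univ v₀ :=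
    funext fun t => (hβ t).trans (h'.vacancyProb_eq v₀ t)
  have hsol := h'.isBranchSolution (Set.mem_univ v₀) hroot
  -- The rooted tree is itself a branch with root `v₀`, so every branch of `T` has its vacancy
  -- probability.
  have hbr : BlockingRSA.IsBranchVacancy h k (BlockingRSA.vacProb T' τ' P' Set.univ v₀) :=
    fun U v hv hU t ht => BlockingRSA.vacProb_eq_vacProb h h' hv (Set.mem_univ v₀) hU hroot ht
  refine ⟨h.wellDefined, h'.wellDefined, fun t ht => ⟨hsol.pos hk ht, fun m _ => ?_⟩⟩
  have hsum := BlockingRSA.hasSum_expTail m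
    (2 * Real.log (BlockingRSA.vacProb T' τ' P' Set.univ v₀ t))
  refine ⟨hsum.summable, fun v w hvw => ?_⟩
  -- The one-site probability is the pair probability at distance zero.
  have hone : ∀ v, BlockingRSA.vacProb T τ P Set.univ v t =
      (1 + BlockingRSA.vacProb T' τ' P' Set.univ v₀ t ^ 2) / 2 := fun v => by
    rw [← BlockingRSA.vacProb₂_self, BlockingRSA.vacProb₂_full (m := 0) h hk hbr hsol
      (by simpa using hT.isTree.linked_univ v v) (hT.nearlyRegular _ v v) ht,
      BlockingRSA.fullForm_zero (hsol.pos hk ht)]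
  rw [hsum.tsum_eq, h.siteCov_eq, hone, hone, BlockingRSA.vacProb₂_full h hk hbr hsol
    (hvw ▸ hT.isTree.linked_univ v w) (hT.nearlyRegular _ v w) ht, BlockingRSA.fullForm]
  ring
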